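/- **Theorem.** Let $G=(V,E)$ be a finite simple graph with $n=|V|$ and $m=|E|$. A vertex $u$ ve-dominates every edge of $G$ that is incident to some vertex of the closed neighbourhood $N_G[u]$; a set $S\subseteq V$ is a ve-dominating set if every edge of $G$ is ve-dominated by some vertex of $S$. A block of $G$ is a maximal connected induced subgraph of $G$ that has no cut vertex of its own, where a cut vertex of a graph is a vertex whose removal increases the number of connected components; $G$ is a block graph if each of its blocks is a complete graph ($G$ need not be connected). There is an algorithm that, given the adjacency lists of any block graph $G$ with vertex set $\{0,\dots,n-1\}$ (each list in any order), outputs a ve-dominating set of $G$ of minimum cardinality, together with its cardinality, and runs in $\mathcal{O}(n+m)$ time; that is, there are a single program for a unit-cost random access machine (whose only arithmetic operations are adding and subtracting one) and a constant $C$ such that on each such input the program halts within $C\,(n+m+1)$ steps. -/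

import Mathlib

namespace VEDom

/-! ### ve-domination and block graphs -/

section Graphs

variable {V : Type*}

/-- `u` ve-dominates every edge that is incident to some vertex of the closed neighbourhood
`N[u]`. -/
def VEDominates (G : SimpleGraph V) (u : V) (e : Sym2 V) : Prop :=
  ∃ x ∈ insert u (G.neighborSet u), e ∈ G.incidenceSet x

/-- `S` is a ve-dominating set: every edge is ve-dominated by some vertex of `S`. -/
def IsVEDominatingSet (G : SimpleGraph V) (S : Finset V) : Prop :=
  ∀ e ∈ G.edgeSet, ∃ u ∈ S, VEDominates G u e

/-- A ve-dominating set of minimum cardinality. -/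
def IsMinimumVEDominatingSet (G : SimpleGraph V) (S : Finset V) : Prop :=
  IsVEDominatingSet G S ∧ ∀ T : Finset V, IsVEDominatingSet G T → S.card ≤ T.card

/-- `v` is a cut vertex (of a finite graph): its removal increases the number of connected
components. -/
def IsCutVertex (G : SimpleGraph V) (v : V) : Prop :=
  Nat.card G.ConnectedComponent < Nat.card (G.induce {v}ᶜ).ConnectedComponent

/-- `B` is the vertex set of a block: a maximal connected induced subgraph that has no cut vertex
of its own. -/
def IsBlock (G : SimpleGraph V) (B : Set V) : Prop :=
  Maximal (fun A : Set V =>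
    (G.induce A).Connected ∧ ∀ v : A, ¬ IsCutVertex (G.induce A) v) B

/-- A block graph: every block is complete. Connectedness is not required. -/
def IsBlockGraph (G : SimpleGraph V) : Prop :=
  ∀ B : Set V, IsBlock G B → G.IsClique B

end Graphs

/-! ### A random access machine with a step count

The machine has registers `0, 1, 2, …` and arrays `0, 1, 2, …` of unbounded length, all of whose
entries are natural numbers. A program is a fixed finite text, so it can name only finitely many
registers and arrays; an array is accessed at the index held in a register. The only arithmetic is
adding or subtracting one, so a number held by the machine exceeds the largest input number and the
constants of the program by at most the number of steps made so far. Hence a run of linear length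
handles only numbers of `O(log n)` bits, and charging one unit of time per instruction is
realistic. -/

/-- The memory of the machine. -/
@[ext]
structure State where
  reg : ℕ → ℕ
  arr : ℕ → ℕ → ℕ

/-- Write `k` to register `x`. -/
def State.setReg (s : State) (x k : ℕ) : State :=
  { s with reg := Function.update s.reg x k }

/-- Write `k` to position `i` of array `a`. -/
def State.setArr (s : State) (a i k : ℕ) : State :=
  { s with arr := Function.update s.arr a (Function.update (s.arr a) i k) }

/-- Comparisons of two registers. -/
inductive Test where
  | eq (x y : ℕ)
  | lt (x y : ℕ)

/-- The outcome of a comparison. -/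
def Test.holds : Test → State → Prop
  | .eq x y, s => s.reg x = s.reg y
  | .lt x y, s => s.reg x < s.reg y

/-- Single instructions. -/
inductive Instr where
  /-- `x := k` -/
  | const (x k : ℕ)
  /-- `x := y` -/
  | copy (x y : ℕ)
  /-- `x := x + 1` -/
  | succ (x : ℕ)
  /-- `x := x - 1`, truncated at `0` -/
  | pred (x : ℕ)
  /-- `x := a[y]` -/
  | load (x a y : ℕ)
  /-- `a[y] := x` -/
  | store (a y x : ℕ)

/-- The effect of a single instruction. -/
def Instr.exec : Instr → State → State
  | .const x k, s => s.setReg x k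
  | .copy x y, s => s.setReg x (s.reg y)
  | .succ x, s => s.setReg x (s.reg x + 1)
  | .pred x, s => s.setReg x (s.reg x - 1)
  | .load x a y, s => s.setReg x (s.arr a (s.reg y))
  | .store a y x, s => s.setArr a (s.reg y) (s.reg x)

/-- Programs. -/
inductive Program where
  | skip
  | instr (i : Instr)
  | seq (p q : Program)
  | ifElse (b : Test) (p q : Program)
  | loop (b : Test) (p : Program)

/-- `Run p s t s'`: started in memory `s`, the program `p` halts after exactly `t` steps with
memory `s'`. Every executed instruction and every evaluated test costs one step. -/
inductive Run : Program → State → ℕ → State → Prop where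
  | skip (s : State) : Run .skip s 1 s
  | instr (i : Instr) (s : State) : Run (.instr i) s 1 (i.exec s)
  | seq {p q : Program} {s s' s'' : State} {t t' : ℕ} :
      Run p s t s' → Run q s' t' s'' → Run (.seq p q) s (t + t') s''
  | ifTrue {b : Test} {p q : Program} {s s' : State} {t : ℕ} :
      b.holds s → Run p s t s' → Run (.ifElse b p q) s (t + 1) s'
  | ifFalse {b : Test} {p q : Program} {s s' : State} {t : ℕ} :
      ¬ b.holds s → Run q s t s' → Run (.ifElse b p q) s (t + 1) s'
  | loopDone {b : Test} {p : Program} {s : State} :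
      ¬ b.holds s → Run (.loop b p) s 1 s
  | loopStep {b : Test} {p : Program} {s s' s'' : State} {t t' : ℕ} :
      b.holds s → Run p s t s' → Run (.loop b p) s' t' s'' →
      Run (.loop b p) s (t + t' + 1) s''

/-- The machine is deterministic: running time and result of a halting run are unique. -/
theorem Run.deterministic {p : Program} {s s₁ : State} {t₁ : ℕ} (h₁ : Run p s t₁ s₁) :
    ∀ {t₂ : ℕ} {s₂ : State}, Run p s t₂ s₂ → t₁ = t₂ ∧ s₁ = s₂ := by
  induction h₁ with
  | skip s => intro t₂ s₂ h; cases h; exact ⟨rfl, rfl⟩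
  | instr i s => intro t₂ s₂ h; cases h; exact ⟨rfl, rfl⟩
  | seq _ _ ih₁ ih₂ =>
    intro t₂ s₂ h
    cases h with
    | seq a b =>
      obtain ⟨rfl, rfl⟩ := ih₁ a
      obtain ⟨rfl, rfl⟩ := ih₂ b
      exact ⟨rfl, rfl⟩
  | ifTrue hb _ ih =>
    intro t₂ s₂ h
    cases h with
    | ifTrue _ a => obtain ⟨rfl, rfl⟩ := ih a; exact ⟨rfl, rfl⟩
    | ifFalse hb' _ => exact absurd hb hb'
  | ifFalse hb _ ih =>
    intro t₂ s₂ h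
    cases h with
    | ifTrue hb' _ => exact absurd hb' hb
    | ifFalse _ a => obtain ⟨rfl, rfl⟩ := ih a; exact ⟨rfl, rfl⟩
  | loopDone hb =>
    intro t₂ s₂ h
    cases h with
    | loopDone _ => exact ⟨rfl, rfl⟩
    | loopStep hb' _ _ => exact absurd hb' hb
  | loopStep hb _ _ ih₁ ih₂ =>
    intro t₂ s₂ h
    cases h with
    | loopDone hb' => exact absurd hb hb'
    | loopStep _ a b =>
      obtain ⟨rfl, rfl⟩ := ih₁ a
      obtain ⟨rfl, rfl⟩ := ih₂ b
      exact ⟨rfl, rfl⟩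

/-! ### Input and output -/

/-- `adj` gives adjacency lists of `G`: the list of `v` names every neighbour of `v` exactly once,
in any order. -/
def IsAdjacencyList {n : ℕ} (G : SimpleGraph (Fin n)) (adj : Fin n → List (Fin n)) : Prop :=
  ∀ v, (adj v).Nodup ∧ ∀ u, u ∈ adj v ↔ G.Adj v u

/-- The initial memory. Register `0` holds the number `n` of vertices. Array `1` holds the
adjacency lists of the vertices `0, …, n - 1`, one after the other; array `0` holds their bounds:
the list of vertex `v` occupies the positions `i` of array `1` with
`arr 0 v ≤ i < arr 0 (v + 1)`. Everything else is `0`. -/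
def inputState {n : ℕ} (adj : Fin n → List (Fin n)) : State where
  reg x := if x = 0 then n else 0
  arr a i :=
    if a = 0 then ((List.ofFn adj).take i).flatten.length
    else if a = 1 then (((List.ofFn adj).flatten.map Fin.val)[i]?).getD 0
    else 0

/-- The final memory `s` lists the set `S` without repetition: register `1` holds its cardinality
`k`, and the first `k` entries of array `2` are its elements. -/
def Outputs {n : ℕ} (s : State) (S : Finset (Fin n)) : Prop :=
  s.reg 1 = S.card ∧ ∀ v : Fin n, v ∈ S ↔ ∃ i < s.reg 1, s.arr 2 i = (v : ℕ)

end VEDom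

/-!
Choose a breadth-first search forest and treat the vertices in reverse order of discovery. When `v`
is treated, look at the edges `vx` with `x` not the parent of `v`; if one of them is not yet
ve-dominated, select the parent of `v` (or `v` itself, if `v` is a root) and charge the selection to
that edge. The charged edges have pairwise no common ve-dominator, so that every ve-dominating set
has at least as many elements as the selected one.

The last claim is where block graphs enter. The vertices of a cycle in a block graph form a clique,
so breadth-first search leaves only edges between a parent and its child and between two children
of the same parent. It follows that a vertex which ve-dominates an edge `vx` with `v` treated late
and another such edge `uy` with `u` treated earlier can be replaced by the parent of `u`: the
selection made for `uy` has taken care of `vx` already.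
-/

namespace VEDom

open SimpleGraph

/-! ### Cycles of block graphs -/

section BlockGraphs

variable {V : Type*} {G : SimpleGraph V}

theorem connected_induce_support_sdiff_singleton {v c : V} {w : G.Walk v v} (hw : w.IsCycle)
    (hc : c ∈ w.support) : (G.induce ({x | x ∈ w.support} \ {c})).Connected := by
  classical
  obtain ⟨w, hw, hsupp⟩ : ∃ w' : G.Walk c c, w'.IsCycle ∧ ∀ x, x ∈ w'.support ↔ x ∈ w.support :=
    ⟨w.rotate c hc, (Walk.isCycle_rotate hc).2 hw, fun x => w.mem_support_rotate_iff c hc⟩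
  cases w with
  | nil => exact absurd rfl hw.ne_nil
  | cons hadj r =>
    have hr := (Walk.cons_isCycle_iff r hadj).1 hw |>.1
    have hsplit := Walk.support_dropLast_concat
      (Walk.not_nil_of_ne hadj.ne' : ¬ r.Nil)
    have hnodup := hr.support_nodup
    rw [← hsplit, List.nodup_append] at hnodup
    suffices hset : {x | x ∈ w.support} \ {c} = {x | x ∈ r.dropLast.support} by
      rw [hset]
      exact r.dropLast.connected_induce_support
    ext x
    have hne : x ∈ r.dropLast.support → x ≠ c := fun h => hnodup.2.2 x h c (by simp)
    simp only [Set.mem_sdiff, Set.mem_ofPred_eq, Set.mem_singleton_iff, ← hsupp,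
      Walk.support_cons, ← hsplit, List.mem_cons, List.mem_append, List.not_mem_nil]
    tauto

theorem IsBlockGraph.isClique_of_connected_sdiff_singleton [Finite V] (hG : IsBlockGraph G)
    {A : Set V} (hA : (G.induce A).Connected)
    (hcut : ∀ c ∈ A, (G.induce (A \ {c})).Preconnected) : G.IsClique A := by
  have not_cut (c : A) : ¬ IsCutVertex (G.induce A) c := by
    let f : G.induce (A \ {c.1}) →g (G.induce A).induce {c}ᶜ :=
      { toFun := fun x => ⟨⟨x, x.2.1⟩, fun h => x.2.2 (congrArg Subtype.val h)⟩
        map_rel' := id }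
    have hf : Function.Surjective f := fun ⟨⟨x, hx⟩, hxc⟩ =>
      ⟨⟨x, hx, fun h => hxc (Subtype.ext h)⟩, rfl⟩
    have := ((hcut c c.2).map f hf).subsingleton_connectedComponent
    have : Nonempty (G.induce A).ConnectedComponent := ⟨(G.induce A).connectedComponentMk c⟩
    exact (Finite.card_le_one_iff_subsingleton.2 ‹_›).trans Nat.card_pos |>.not_gt
  obtain ⟨B, hAB, hB⟩ := Finite.exists_le_maximal
    (p := fun A : Set V => (G.induce A).Connected ∧ ∀ v : A, ¬ IsCutVertex (G.induce A) v)
    ⟨hA, not_cut⟩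
  exact (hG B hB).subset hAB

theorem IsBlockGraph.isClique_support_of_isCycle [Finite V] (hG : IsBlockGraph G) {v : V}
    {w : G.Walk v v} (hw : w.IsCycle) : G.IsClique {x | x ∈ w.support} :=
  hG.isClique_of_connected_sdiff_singleton w.connected_induce_support fun _ hc =>
    (connected_induce_support_sdiff_singleton hw hc).preconnected

theorem IsBlockGraph.eq_or_adj_of_walk [Finite V] (hG : IsBlockGraph G) {v a b : V}
    (ha : G.Adj v a) (hb : G.Adj v b) (q : G.Walk a b) (hv : v ∉ q.support) :
    a = b ∨ G.Adj a b := by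
  classical
  rw [or_iff_not_imp_left]
  intro hab
  have hvr : v ∉ q.bypass.support := fun h => hv (q.support_bypass_subset_support h)
  have hcycle : (Walk.cons ha (q.bypass.concat hb.symm)).IsCycle := by
    rw [Walk.cons_isCycle_iff, Walk.concat_isPath_iff,
      Walk.edges_concat, List.concat_eq_append, List.mem_append, List.mem_singleton]
    refine ⟨⟨q.bypass_isPath, hvr⟩, ?_⟩
    rintro (he | he)
    · exact hvr (q.bypass.fst_mem_support_of_mem_edges he)
    · rw [Sym2.eq_swap, Sym2.congr_left] at he
      exact hab he
  exact hG.isClique_support_of_isCycle hcycle (by simp [Walk.support_concat])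
    (by simp [Walk.support_concat]) hab

end BlockGraphs

/-! ### Breadth-first orders -/

/-- `pos` enumerates the vertices in the order of a breadth-first search with parent function `p`;
the starting vertices of the search are their own parents. -/
structure IsBreadthFirst {V : Type*} (G : SimpleGraph V) (pos : V → ℕ) (p : V → V) : Prop where
  injective : Function.Injective pos
  parent_le : ∀ v, pos (p v) ≤ pos v
  parent_mono : ∀ u v, pos u ≤ pos v → pos (p u) ≤ pos (p v)
  parent_adj : ∀ v, p v = v ∨ G.Adj (p v) v
  parent_min : ∀ u v, G.Adj u v → pos (p v) ≤ pos u

/-- `x` is a neighbour of `v` other than its parent. The edges `vx` of this kind are the ones that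
the greedy algorithm inspects when it treats `v`. -/
def NonparentAdj {V : Type*} (G : SimpleGraph V) (p : V → V) (v x : V) : Prop :=
  G.Adj v x ∧ x ≠ p v

section BreadthFirst

variable {V : Type*} {G : SimpleGraph V} {pos : V → ℕ} {p : V → V}

theorem IsBreadthFirst.eq_of_le_of_le (h : IsBreadthFirst G pos p) {u v : V}
    (huv : pos u ≤ pos v) (hvu : pos v ≤ pos u) : u = v :=
  h.injective (huv.antisymm hvu)

theorem IsBreadthFirst.adj_of_parent_lt (h : IsBreadthFirst G pos p) {v : V}
    (hlt : pos (p v) < pos v) : G.Adj (p v) v :=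
  (h.parent_adj v).resolve_left fun e => hlt.ne (congrArg pos e)

theorem IsBreadthFirst.exists_walk (h : IsBreadthFirst G pos p) (a b : V)
    (hba : pos (p b) ≤ pos a) (hab : pos a ≤ pos b) :
    ∃ q : G.Walk a b, ∀ x ∈ q.support, pos x ≤ pos b := by
  induction hk : pos a + pos b using Nat.strong_induction_on generalizing a b with
  | _ k ih =>
    rcases (h.parent_le b).eq_or_lt with hb | hb
    · obtain rfl := h.eq_of_le_of_le hab (hb ▸ hba)
      exact ⟨.nil, by simp⟩
    · obtain ⟨q, hq⟩ := ih (pos (p b) + pos a) (by lia) (p b) a (h.parent_mono _ _ hab) hba rfl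
      refine ⟨q.reverse.concat (h.adj_of_parent_lt hb), fun x hx => ?_⟩
      rw [Walk.support_concat, Walk.support_reverse, List.mem_append, List.mem_reverse,
        List.mem_singleton] at hx
      rcases hx with hx | rfl
      · exact (hq x hx).trans hab
      · exact le_rfl

theorem IsBreadthFirst.adj_parent_of_ne [Finite V] (h : IsBreadthFirst G pos p)
    (hG : IsBlockGraph G) {u v : V} (huv : G.Adj u v) (hlt : pos u < pos v) (hne : u ≠ p v) :
    pos (p v) < pos u ∧ G.Adj (p v) u := by
  have hpu : pos (p v) < pos u :=
    (h.parent_min u v huv).lt_of_ne fun e => hne (h.injective e).symm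
  obtain ⟨q, hq⟩ := h.exists_walk (p v) u (h.parent_mono _ _ hlt.le) hpu.le
  have hv : v ∉ q.support := fun hm => (hq v hm).not_gt hlt
  exact ⟨hpu, (hG.eq_or_adj_of_walk (h.adj_of_parent_lt (hpu.trans hlt)).symm huv.symm q hv
    ).resolve_left hne.symm⟩

/-- Otherwise `u, v, p u, p v` are distinct with `p u < p v < u < v`, and the walk `v, u, p u`
around `p v` makes `v` a neighbour of `p u`, although `p v` is its first neighbour. -/
theorem IsBreadthFirst.eq_parent_or_parent_eq [Finite V] (h : IsBreadthFirst G pos p)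
    (hG : IsBlockGraph G) {u v : V} (huv : G.Adj u v) (hlt : pos u < pos v) :
    u = p v ∨ p u = p v := by
  by_contra! ⟨hne, hpne⟩
  obtain ⟨hpvu, hpv_adj⟩ := h.adj_parent_of_ne hG huv hlt hne
  obtain ⟨hpupv, hpu_adj⟩ := h.adj_parent_of_ne hG hpv_adj hpvu hpne.symm
  have hpv : G.Adj (p v) v := h.adj_of_parent_lt (hpvu.trans hlt)
  have hpu : G.Adj (p u) u := h.adj_of_parent_lt (hpupv.trans hpvu)
  let q : G.Walk v (p u) := .cons huv.symm (.cons hpu.symm .nil)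
  have hq : p v ∉ q.support := by
    simp [q, hpv.ne, hne.symm, hpne.symm]
  rcases hG.eq_or_adj_of_walk hpv hpu_adj.symm q hq with e | e
  · exact (hpupv.trans (hpvu.trans hlt)).ne (congrArg pos e.symm)
  · exact hpupv.not_ge (h.parent_min _ _ e.symm)

theorem IsBreadthFirst.adj_cases [Finite V] (h : IsBreadthFirst G pos p)
    (hG : IsBlockGraph G) {u v : V} (huv : G.Adj u v) : u = p v ∨ v = p u ∨ p u = p v := by
  rcases lt_trichotomy (pos u) (pos v) with hlt | he | hlt
  · exact (h.eq_parent_or_parent_eq hG huv hlt).imp_right .inr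
  · exact absurd (h.injective he) huv.ne
  · exact .inr ((h.eq_parent_or_parent_eq hG huv.symm hlt).imp_right .symm)

theorem IsBreadthFirst.nonparentAdj_or (h : IsBreadthFirst G pos p) {v x : V} (hvx : G.Adj v x) :
    NonparentAdj G p v x ∨ NonparentAdj G p x v := by
  by_contra! ⟨hv, hx⟩
  have hxv : x = p v := by_contra fun hne => hv ⟨hvx, hne⟩
  have hvx' : v = p x := by_contra fun hne => hx ⟨hvx.symm, hne⟩
  exact hvx.ne (h.eq_of_le_of_le (hvx' ▸ h.parent_le x) (hxv ▸ h.parent_le v))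

theorem NonparentAdj.parent_lt {v x : V} (hvx : NonparentAdj G p v x)
    (h : IsBreadthFirst G pos p) : pos (p v) < pos x :=
  (h.parent_min x v hvx.1.symm).lt_of_ne fun e => hvx.2 (h.injective e).symm

theorem NonparentAdj.parent_eq [Finite V] {v x : V} (hvx : NonparentAdj G p v x)
    (h : IsBreadthFirst G pos p) (hG : IsBlockGraph G) : p x = v ∨ p x = p v := by
  rcases h.adj_cases hG hvx.1 with e | e | e
  · exact .inl e.symm
  · exact absurd e hvx.2
  · exact .inr e.symm

/-! ### Edges with a common ve-dominator -/

theorem veDominates_mk_iff {v x w : V} (hvx : G.Adj v x) :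
    VEDominates G w s(v, x) ↔ (w = v ∨ G.Adj w v) ∨ (w = x ∨ G.Adj w x) := by
  simp only [VEDominates, Set.mem_insert_iff, mem_neighborSet, incidenceSet, mem_edgeSet,
    Sym2.mem_iff, Set.mem_ofPred_eq, hvx, true_and]
  aesop

theorem IsBreadthFirst.veDominates_parent (h : IsBreadthFirst G pos p) {v x : V}
    (hvx : G.Adj v x) : VEDominates G (p v) s(v, x) :=
  (veDominates_mk_iff hvx).2 (.inl (h.parent_adj v))

theorem NonparentAdj.cases_of_veDominates [Finite V] {v x w : V} (hvx : NonparentAdj G p v x)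
    (h : IsBreadthFirst G pos p) (hG : IsBlockGraph G) (hw : VEDominates G w s(v, x)) :
    w = p v ∨ p w = v ∨ p w = p v ∨ p w = x := by
  have hx := hvx.parent_eq h hG
  rcases (veDominates_mk_iff hvx.1).1 hw with (rfl | e) | (rfl | e)
  · exact .inr (.inr (.inl rfl))
  · rcases h.adj_cases hG e with e | e | e <;> simp [e]
  · rcases hx with e | e <;> simp [e]
  · rcases h.adj_cases hG e with e | e | e
    · rcases hx with e' | e' <;> simp [e, e']
    · simp [e]
    · rcases hx with e' | e' <;> simp [e, e']

theorem IsBreadthFirst.veDominates_parent_of_mem (h : IsBreadthFirst G pos p) {v v' x' : V}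
    (hvx' : G.Adj v' x') (hle : pos v' ≤ pos v) (hv : v = v' ∨ v = p v' ∨ v = x') :
    VEDominates G (p v) s(v', x') := by
  rcases hv with rfl | rfl | rfl
  · exact h.veDominates_parent hvx'
  · have hv' : p v' = v' := h.eq_of_le_of_le (h.parent_le v') hle
    rw [hv']
    exact h.veDominates_parent hvx'
  · rw [Sym2.eq_swap]
    exact h.veDominates_parent hvx'.symm

theorem NonparentAdj.veDominates_parent_of_mem [Finite V] {v x v' x' : V}
    (hvx : NonparentAdj G p v x) (h : IsBreadthFirst G pos p) (hG : IsBlockGraph G)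
    (hvx' : NonparentAdj G p v' x') (hle : pos v' ≤ pos v) (hx : x = v' ∨ x = p v' ∨ x = x') :
    VEDominates G (p v) s(v', x') := by
  have hlt := hvx.parent_lt h
  rcases hx with rfl | rfl | rfl
  · rcases hvx.parent_eq h hG with e | e
    · exact absurd (h.eq_of_le_of_le hle (e ▸ h.parent_le x)) hvx.1.ne'
    · exact e ▸ h.veDominates_parent hvx'.1
  · exact absurd (h.parent_mono _ _ hle) hlt.not_ge
  · rcases hvx.parent_eq h hG with e | e
    · refine h.veDominates_parent_of_mem hvx'.1 hle ?_
      rcases hvx'.parent_eq h hG with e' | e' <;> simp [← e, e']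
    · rw [← e, Sym2.eq_swap]
      exact h.veDominates_parent hvx'.1.symm

/-- If two edges have a common ve-dominator `w`, then selecting the parent when the first of them
is treated takes care of the other one as well. -/
theorem NonparentAdj.veDominates_parent_of_common [Finite V] {v x v' x' w : V}
    (hvx : NonparentAdj G p v x) (h : IsBreadthFirst G pos p) (hG : IsBlockGraph G)
    (hvx' : NonparentAdj G p v' x') (hle : pos v' ≤ pos v)
    (hw : VEDominates G w s(v, x)) (hw' : VEDominates G w s(v', x')) :
    VEDominates G (p v) s(v', x') := by
  rcases hvx.cases_of_veDominates h hG hw with rfl | hpw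
  · exact hw'
  have hpv' : VEDominates G (p v') s(v', x') := h.veDominates_parent hvx'.1
  have hparent := h.parent_mono _ _ hle
  rcases hvx'.cases_of_veDominates h hG hw' with rfl | hpw'
  · rcases hpw with e | e | e
    · exact h.veDominates_parent_of_mem hvx'.1 hle <| .inl <|
        h.eq_of_le_of_le (e ▸ (h.parent_le _).trans (h.parent_le _)) hle
    · rw [h.eq_of_le_of_le (e ▸ h.parent_le _) hparent]
      exact hpv'
    · exact absurd (e ▸ (h.parent_le _).trans hparent) (hvx.parent_lt h).not_ge
  · rcases hpw with e | e | e <;> rw [e] at hpw'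
    · exact h.veDominates_parent_of_mem hvx'.1 hle hpw'
    · rcases hpw' with e' | e' | e'
      · exact (veDominates_mk_iff hvx'.1).2 (.inl (.inl e'))
      · exact e' ▸ hpv'
      · exact (veDominates_mk_iff hvx'.1).2 (.inr (.inl e'))
    · exact hvx.veDominates_parent_of_mem h hG hvx' hle hpw'

end BreadthFirst

/-! ### Greedy selection in reverse breadth-first order -/

section Greedy

variable {V : Type*} {G : SimpleGraph V} {pos : V → ℕ} {p : V → V}

/-- `v` lies in the closed neighbourhood of `S`, so that `S` ve-dominates all edges at `v`. -/
def Covered (G : SimpleGraph V) (S : Finset V) (v : V) : Prop :=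
  ∃ s ∈ S, s = v ∨ G.Adj s v

/-- `F` is a set of edges no two of which have a common ve-dominator; the dual notion to
ve-dominating sets. -/
def IsVEPacking (G : SimpleGraph V) (F : Finset (Sym2 V)) : Prop :=
  (∀ e ∈ F, e ∈ G.edgeSet) ∧
    ∀ e ∈ F, ∀ f ∈ F, ∀ w, VEDominates G w e → VEDominates G w f → e = f

theorem covered_insert [DecidableEq V] {S : Finset V} {s v : V} :
    Covered G (insert s S) v ↔ (s = v ∨ G.Adj s v) ∨ Covered G S v := by
  simp [Covered]

theorem exists_veDominates_iff_covered {S : Finset V} {v x : V} (hvx : G.Adj v x) :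
    (∃ s ∈ S, VEDominates G s s(v, x)) ↔ Covered G S v ∨ Covered G S x := by
  simp only [veDominates_mk_iff hvx, Covered, and_or_left, exists_or]

theorem IsVEPacking.card_le_card {F : Finset (Sym2 V)} (hF : IsVEPacking G F) {T : Finset V}
    (hT : IsVEDominatingSet G T) : F.card ≤ T.card :=
  Finset.card_le_card_of_forall_subsingleton (fun e w => VEDominates G w e)
    (fun e he => hT e (hF.1 e he))
    fun w _ e he f hf => hF.2 e he.1 f hf.1 w he.2 hf.2

theorem IsVEPacking.insert [DecidableEq V] {F : Finset (Sym2 V)} (hF : IsVEPacking G F)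
    {e : Sym2 V} (he : e ∈ G.edgeSet)
    (hdisj : ∀ f ∈ F, ∀ w, VEDominates G w f → ¬ VEDominates G w e) :
    IsVEPacking G (insert e F) := by
  simp only [IsVEPacking, Finset.forall_mem_insert]
  exact ⟨⟨he, hF.1⟩, ⟨fun _ _ _ => trivial, fun f hf w hw hwf => absurd hw (hdisj f hf w hwf)⟩,
    fun f hf => ⟨fun w hwf hw => absurd hw (hdisj f hf w hwf), hF.2 f hf⟩⟩

/-- Some edge `vx` that the greedy algorithm inspects when it treats `v` is not ve-dominated by
`S`. -/
def NeedsParent (G : SimpleGraph V) (p : V → V) (S : Finset V) (v : V) : Prop :=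
  ¬ Covered G S v ∧ ∃ x, NonparentAdj G p v x ∧ ¬ Covered G S x

open Classical in
/-- The set selected by the greedy algorithm after it has treated `v`, if it was `S` before. -/
noncomputable def greedyStep [DecidableEq V] (G : SimpleGraph V) (p : V → V) (S : Finset V)
    (v : V) : Finset V :=
  if NeedsParent G p S v then insert (p v) S else S

theorem subset_greedyStep [DecidableEq V] (G : SimpleGraph V) (p : V → V) (S : Finset V) (v : V) :
    S ⊆ greedyStep G p S v := by
  unfold greedyStep
  split_ifs
  exacts [Finset.subset_insert _ _, subset_rfl]

/-- The state of the greedy algorithm when exactly the vertices `v` with `k ≤ pos v` have been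
treated: `S` has been selected, and `F` is a packing that certifies its optimality. -/
structure GreedyInvariant (G : SimpleGraph V) (pos : V → ℕ) (p : V → V) (k : ℕ)
    (S : Finset V) (F : Finset (Sym2 V)) : Prop where
  card_le : S.card ≤ F.card
  packing : IsVEPacking G F
  origin : ∀ e ∈ F, ∃ v x, e = s(v, x) ∧ NonparentAdj G p v x ∧ k ≤ pos v ∧ p v ∈ S
  covered : ∀ v x, NonparentAdj G p v x → k ≤ pos v → Covered G S v ∨ Covered G S x

theorem GreedyInvariant.empty {k : ℕ} (hk : ∀ v, pos v < k) : GreedyInvariant G pos p k ∅ ∅ where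
  card_le := le_rfl
  packing := by simp [IsVEPacking]
  origin := by simp
  covered v _ _ hv := absurd (hk v) hv.not_gt

theorem GreedyInvariant.not_veDominates [Finite V] {k : ℕ} {S : Finset V} {F : Finset (Sym2 V)}
    {v x : V} (hI : GreedyInvariant G pos p k S F) (h : IsBreadthFirst G pos p)
    (hG : IsBlockGraph G) (hv : pos v ≤ k) (hvx : NonparentAdj G p v x)
    (hcov : ¬ (Covered G S v ∨ Covered G S x)) (e : Sym2 V) (he : e ∈ F) (w : V)
    (hw : VEDominates G w e) : ¬ VEDominates G w s(v, x) := by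
  intro hw'
  obtain ⟨u, y, rfl, huy, hk, hS⟩ := hI.origin e he
  have := huy.veDominates_parent_of_common h hG hvx (hv.trans hk) hw hw'
  exact hcov ((exists_veDominates_iff_covered hvx.1).1 ⟨p u, hS, this⟩)

theorem GreedyInvariant.step_of_needsParent [Finite V] [DecidableEq V] {k : ℕ} {S : Finset V}
    {F : Finset (Sym2 V)} {v : V} (hI : GreedyInvariant G pos p (k + 1) S F)
    (h : IsBreadthFirst G pos p) (hG : IsBlockGraph G) (hv : pos v = k)
    (hneeds : NeedsParent G p S v) : ∃ F', GreedyInvariant G pos p k (insert (p v) S) F' := by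
  obtain ⟨hcv, x, hvx, hcx⟩ := hneeds
  have hpS : p v ∉ S := fun hm => hcv ⟨p v, hm, h.parent_adj v⟩
  have hdisj := hI.not_veDominates h hG (by lia) hvx (not_or.2 ⟨hcv, hcx⟩)
  have hF : s(v, x) ∉ F := fun hm =>
    hdisj _ hm (p v) (h.veDominates_parent hvx.1) (h.veDominates_parent hvx.1)
  refine ⟨insert s(v, x) F, ?_, hI.packing.insert hvx.1 hdisj, ?_, fun u y huy hk => ?_⟩
  · rw [Finset.card_insert_of_notMem hpS, Finset.card_insert_of_notMem hF]
    exact Nat.succ_le_succ hI.card_le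
  · rw [Finset.forall_mem_insert]
    refine ⟨⟨v, x, rfl, hvx, hv.ge, Finset.mem_insert_self _ _⟩, fun e he => ?_⟩
    obtain ⟨u, y, he, huy, hk, hS⟩ := hI.origin e he
    exact ⟨u, y, he, huy, (Nat.le_succ k).trans hk, Finset.mem_insert_of_mem hS⟩
  · rcases hk.eq_or_lt with hk | hk
    · obtain rfl : v = u := h.injective (hv.trans hk)
      exact .inl (covered_insert.2 (.inl (h.parent_adj v)))
    · exact (hI.covered u y huy hk).imp (covered_insert.2 <| .inr ·) (covered_insert.2 <| .inr ·)

theorem GreedyInvariant.step_of_not_needsParent {k : ℕ} {S : Finset V} {F : Finset (Sym2 V)}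
    {v : V} (hI : GreedyInvariant G pos p (k + 1) S F) (h : IsBreadthFirst G pos p)
    (hv : pos v = k) (hneeds : ¬ NeedsParent G p S v) : GreedyInvariant G pos p k S F where
  card_le := hI.card_le
  packing := hI.packing
  origin e he :=
    let ⟨u, y, he, huy, hk, hS⟩ := hI.origin e he
    ⟨u, y, he, huy, (Nat.le_succ k).trans hk, hS⟩
  covered u y huy hk := by
    rcases hk.eq_or_lt with hk | hk
    · obtain rfl : v = u := h.injective (hv.trans hk)
      by_contra! ⟨hcv, hcy⟩
      exact hneeds ⟨hcv, y, huy, hcy⟩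
    · exact hI.covered u y huy hk

theorem GreedyInvariant.step [Finite V] [DecidableEq V] {k : ℕ} {S : Finset V}
    {F : Finset (Sym2 V)} {v : V} (hI : GreedyInvariant G pos p (k + 1) S F)
    (h : IsBreadthFirst G pos p) (hG : IsBlockGraph G) (hv : pos v = k) :
    ∃ F', GreedyInvariant G pos p k (greedyStep G p S v) F' := by
  unfold greedyStep
  split_ifs with hneeds
  · exact hI.step_of_needsParent h hG hv hneeds
  · exact ⟨F, hI.step_of_not_needsParent h hv hneeds⟩

theorem GreedyInvariant.isMinimumVEDominatingSet {S : Finset V} {F : Finset (Sym2 V)}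
    (hI : GreedyInvariant G pos p 0 S F) (h : IsBreadthFirst G pos p) :
    IsMinimumVEDominatingSet G S := by
  refine ⟨fun e => ?_, fun T hT => hI.card_le.trans (hI.packing.card_le_card hT)⟩
  induction e using Sym2.ind with
  | _ v x =>
    intro hvx
    rw [exists_veDominates_iff_covered hvx]
    rcases h.nonparentAdj_or hvx with hn | hn
    · exact hI.covered v x hn (Nat.zero_le _)
    · exact (hI.covered x v hn (Nat.zero_le _)).symm

end Greedy

/-! ### Breadth-first search -/

section Search

variable {V : Type*} {G : SimpleGraph V} {l : List V} {h : ℕ} {p : V → V}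

/-- `SearchState G l h p` holds for the states that a breadth-first search of `G` can reach: `l` is
the list of discovered vertices in the order of their discovery, the queue consists of its entries
from position `h` on, and `p` maps each vertex of `l` to its parent. A vertex `x` is discovered
either from the head of the queue or, when the queue is empty, as the root of a new component; in
the second case it becomes its own parent. In both cases the parent stands at position `h` once `x`
has been appended. -/
inductive SearchState (G : SimpleGraph V) : List V → ℕ → (V → V) → Prop
  | nil (p : V → V) : SearchState G [] 0 p
  | discover {l : List V} {h : ℕ} {p p' : V → V} {x : V} : SearchState G l h p → x ∉ l →
      (∀ v ∈ l, p' v = p v) → (l ++ [x])[h]? = some (p' x) → (p' x = x ∨ G.Adj (p' x) x) →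
      SearchState G (l ++ [x]) h p'
  | advance {l : List V} {h : ℕ} {p : V → V} {u : V} : SearchState G l h p → l[h]? = some u →
      (∀ x, G.Adj u x → x ∈ l) → SearchState G l (h + 1) p

namespace SearchState

theorem nodup (hS : SearchState G l h p) : l.Nodup := by
  induction hS with
  | nil => exact List.nodup_nil
  | discover _ hx _ _ _ ih => exact List.nodup_append.2 ⟨ih, List.nodup_singleton _, by grind⟩
  | advance _ _ _ ih => exact ih

theorem head_le (hS : SearchState G l h p) : h ≤ l.length := by
  induction hS with
  | nil => exact le_rfl
  | discover _ _ _ _ _ ih => exact ih.trans (by simp)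
  | advance _ hu _ _ => exact (List.getElem?_eq_some_iff.1 hu).1

theorem parent_adj (hS : SearchState G l h p) {v : V} (hv : v ∈ l) : p v = v ∨ G.Adj (p v) v := by
  induction hS with
  | nil => simp at hv
  | discover _ _ hp _ hadj ih =>
    rcases List.mem_append.1 hv with hv | hv
    · rw [hp v hv]
      exact ih hv
    · rw [List.mem_singleton.1 hv]
      exact hadj
  | advance _ _ _ ih => exact ih hv

theorem parent_mem (hS : SearchState G l h p) {v : V} (hv : v ∈ l) : p v ∈ l := by
  induction hS with
  | nil => simp at hv
  | discover _ _ hp hhead _ ih =>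
    rcases List.mem_append.1 hv with hv | hv
    · rw [hp v hv]
      exact List.mem_append_left _ (ih hv)
    · rw [List.mem_singleton.1 hv]
      exact List.mem_of_getElem? hhead
  | advance _ _ _ ih => exact ih hv

variable [DecidableEq V]

theorem idxOf_eq (hS : SearchState G l h p) {k : ℕ} {v : V} (hv : l[k]? = some v) :
    l.idxOf v = k := by
  obtain ⟨hk, rfl⟩ := List.getElem?_eq_some_iff.1 hv
  exact hS.nodup.idxOf_getElem k hk

theorem idxOf_parent_le_head (hS : SearchState G l h p) {v : V} (hv : v ∈ l) :
    l.idxOf (p v) ≤ h := by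
  induction hS with
  | nil => simp at hv
  | discover hS hx hp hhead hadj ih =>
    rcases List.mem_append.1 hv with hv | hv
    · rw [hp v hv, List.idxOf_append_of_mem (hS.parent_mem hv)]
      exact ih hv
    · rw [List.mem_singleton.1 hv]
      exact ((hS.discover hx hp hhead hadj).idxOf_eq hhead).le
  | advance _ _ _ ih => exact (ih hv).trans (Nat.le_succ _)

theorem idxOf_parent_le (hS : SearchState G l h p) {v : V} (hv : v ∈ l) :
    l.idxOf (p v) ≤ l.idxOf v := by
  induction hS with
  | nil => simp at hv
  | discover hS hx hp hhead hadj ih =>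
    rcases List.mem_append.1 hv with hv | hv
    · rw [hp v hv, List.idxOf_append_of_mem (hS.parent_mem hv), List.idxOf_append_of_mem hv]
      exact ih hv
    · rw [List.mem_singleton.1 hv, (hS.discover hx hp hhead hadj).idxOf_eq hhead,
        List.idxOf_append_of_notMem hx]
      exact hS.head_le.trans (Nat.le_add_right _ _)
  | advance _ _ _ ih => exact ih hv

theorem idxOf_parent_mono (hS : SearchState G l h p) {u v : V} (hv : v ∈ l)
    (huv : l.idxOf u ≤ l.idxOf v) : l.idxOf (p u) ≤ l.idxOf (p v) := by
  induction hS with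
  | nil => simp at hv
  | @discover l h p p' x hS hx hp hhead hadj ih =>
    have hS' := hS.discover hx hp hhead hadj
    have hu : u ∈ l ++ [x] :=
      List.idxOf_lt_length_iff.1 (huv.trans_lt (List.idxOf_lt_length_of_mem hv))
    rcases List.mem_append.1 hv with hv | hv
    · have hul : u ∈ l := by
        by_contra hul
        rw [List.idxOf_append_of_mem hv, List.idxOf_append_of_notMem hul] at huv
        exact (List.idxOf_lt_length_of_mem hv).not_ge ((Nat.le_add_right _ _).trans huv)
      rw [List.idxOf_append_of_mem hul, List.idxOf_append_of_mem hv] at huv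
      rw [hp u hul, hp v hv, List.idxOf_append_of_mem (hS.parent_mem hul),
        List.idxOf_append_of_mem (hS.parent_mem hv)]
      exact ih hv huv
    · rw [List.mem_singleton.1 hv, hS'.idxOf_eq hhead]
      exact hS'.idxOf_parent_le_head hu
  | advance _ _ _ ih => exact ih hv huv

theorem closed (hS : SearchState G l h p) {u x : V} (hu : u ∈ l) (hlt : l.idxOf u < h)
    (hux : G.Adj u x) : x ∈ l ∧ l.idxOf (p x) ≤ l.idxOf u := by
  induction hS with
  | nil => simp at hu
  | @discover l h p p' y hS _ hp _ _ ih =>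
    have hul : u ∈ l := by
      by_contra hul
      rw [List.idxOf_append_of_notMem hul] at hlt
      exact hlt.not_ge (hS.head_le.trans (Nat.le_add_right _ _))
    rw [List.idxOf_append_of_mem hul] at hlt ⊢
    obtain ⟨hx, hle⟩ := ih hul hlt
    rw [hp x hx, List.idxOf_append_of_mem (hS.parent_mem hx)]
    exact ⟨List.mem_append_left _ hx, hle⟩
  | advance hS hw hall ih =>
    rcases (Nat.lt_succ_iff.1 hlt).lt_or_eq with hlt | heq
    · exact ih hu hlt
    · rw [← hS.idxOf_eq hw, List.idxOf_inj hu] at heq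
      subst heq
      have hx := hall x hux
      exact ⟨hx, (hS.idxOf_parent_le_head hx).trans (hS.idxOf_eq hw).ge⟩

theorem isBreadthFirst (hS : SearchState G l l.length p) (hl : ∀ v, v ∈ l) :
    IsBreadthFirst G l.idxOf p where
  injective u _ := (List.idxOf_inj (hl u)).1
  parent_le v := hS.idxOf_parent_le (hl v)
  parent_mono _ v := hS.idxOf_parent_mono (hl v)
  parent_adj v := hS.parent_adj (hl v)
  parent_min u _ huv := (hS.closed (hl u) (List.idxOf_lt_length_of_mem (hl u)) huv).2

end SearchState

end Search

/-! ### Reasoning about runs -/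

@[simp]
theorem State.reg_setReg (s : State) (x k y : ℕ) :
    (s.setReg x k).reg y = if y = x then k else s.reg y := by
  simp [State.setReg, Function.update_apply]

@[simp]
theorem State.arr_setReg (s : State) (x k : ℕ) : (s.setReg x k).arr = s.arr := rfl

@[simp]
theorem State.reg_setArr (s : State) (a i k : ℕ) : (s.setArr a i k).reg = s.reg := rfl

@[simp]
theorem State.arr_setArr (s : State) (a i k b j : ℕ) :
    (s.setArr a i k).arr b j = if b = a ∧ j = i then k else s.arr b j := by
  by_cases hb : b = a <;> by_cases hj : j = i <;> simp [State.setArr, hb, hj]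

attribute [simp] Instr.exec Test.holds

/-- The memories `s` and `s'` agree except possibly on the registers `xs` and the arrays `as`. -/
structure EqOutside (xs as : List ℕ) (s s' : State) : Prop where
  reg : ∀ x ∉ xs, s'.reg x = s.reg x
  arr : ∀ a ∉ as, s'.arr a = s.arr a

theorem EqOutside.refl (xs as : List ℕ) (s : State) : EqOutside xs as s s :=
  ⟨fun _ _ => rfl, fun _ _ => rfl⟩

theorem EqOutside.trans {xs as : List ℕ} {s s' s'' : State} (h : EqOutside xs as s s')
    (h' : EqOutside xs as s' s'') : EqOutside xs as s s'' :=
  ⟨fun x hx => (h'.reg x hx).trans (h.reg x hx), fun a ha => (h'.arr a ha).trans (h.arr a ha)⟩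

theorem EqOutside.mono {xs xs' as as' : List ℕ} {s s' : State} (h : EqOutside xs as s s')
    (hx : xs ⊆ xs') (ha : as ⊆ as') : EqOutside xs' as' s s' :=
  ⟨fun x hxs => h.reg x (mt (@hx x) hxs), fun a has => h.arr a (mt (@ha a) has)⟩

/-- The registers that an instruction writes to. -/
def Instr.regs : Instr → List ℕ
  | .const x _ | .copy x _ | .succ x | .pred x | .load x _ _ => [x]
  | .store _ _ _ => []

/-- The arrays that an instruction writes to. -/
def Instr.arrs : Instr → List ℕ
  | .store a _ _ => [a]
  | _ => []

/-- The registers that some instruction of a program writes to. -/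
def Program.regs : Program → List ℕ
  | .skip => []
  | .instr i => i.regs
  | .seq p q | .ifElse _ p q => p.regs ++ q.regs
  | .loop _ p => p.regs

/-- The arrays that some instruction of a program writes to. -/
def Program.arrs : Program → List ℕ
  | .skip => []
  | .instr i => i.arrs
  | .seq p q | .ifElse _ p q => p.arrs ++ q.arrs
  | .loop _ p => p.arrs

/-- `s'` differs from `s` at most in the registers and arrays that `p` writes to. -/
abbrev Program.Frame (p : Program) (s s' : State) : Prop :=
  EqOutside p.regs p.arrs s s'

theorem Instr.eqOutside_exec (i : Instr) (s : State) : EqOutside i.regs i.arrs s (i.exec s) := by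
  cases i <;>
    refine ⟨fun x hx => ?_, fun a ha => ?_⟩ <;>
    simp_all [Instr.regs, Instr.arrs, funext_iff]

theorem Run.frame {p : Program} {s s' : State} {t : ℕ} (h : Run p s t s') : p.Frame s s' := by
  induction h with
  | skip | loopDone => exact .refl _ _ _
  | instr i s => exact i.eqOutside_exec s
  | seq _ _ ih ih' =>
    exact (ih.mono (by simp [Program.regs]) (by simp [Program.arrs])).trans
      (ih'.mono (by simp [Program.regs]) (by simp [Program.arrs]))
  | ifTrue _ _ ih | ifFalse _ _ ih =>
    exact ih.mono (by simp [Program.regs]) (by simp [Program.arrs])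
  | loopStep _ _ _ ih ih' => exact ih.trans ih'

/-- Started in `s`, the program `p` halts within `k` steps, with a memory that satisfies `Q`. -/
def HaltsWithin (p : Program) (k : ℕ) (s : State) (Q : State → Prop) : Prop :=
  ∃ t ≤ k, ∃ s', Run p s t s' ∧ Q s'

namespace HaltsWithin

variable {p q : Program} {b : Test} {s : State} {k k' : ℕ} {Q R : State → Prop}

theorem mono (h : HaltsWithin p k s R) (hk : k ≤ k') (hQ : ∀ s', p.Frame s s' → R s' → Q s') :
    HaltsWithin p k' s Q :=
  let ⟨t, ht, s', hr, hR⟩ := h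
  ⟨t, ht.trans hk, s', hr, hQ s' hr.frame hR⟩

theorem of_le (h : HaltsWithin p k s Q) (hk : k ≤ k') : HaltsWithin p k' s Q :=
  h.mono hk fun _ _ hQ => hQ

theorem skip (h : Q s) : HaltsWithin .skip 1 s Q :=
  ⟨1, le_rfl, s, .skip s, h⟩

theorem instr {i : Instr} (h : Q (i.exec s)) : HaltsWithin (.instr i) 1 s Q :=
  ⟨1, le_rfl, i.exec s, .instr i s, h⟩

theorem seq (hp : HaltsWithin p k s R)
    (hq : ∀ s', p.Frame s s' → R s' → HaltsWithin q k' s' Q) :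
    HaltsWithin (.seq p q) (k + k') s Q := by
  obtain ⟨t, ht, s', hr, hR⟩ := hp
  obtain ⟨t', ht', s'', hr', hQ⟩ := hq s' hr.frame hR
  exact ⟨t + t', Nat.add_le_add ht ht', s'', hr.seq hr', hQ⟩

theorem ifElse (hp : b.holds s → HaltsWithin p k s Q) (hq : ¬ b.holds s → HaltsWithin q k s Q) :
    HaltsWithin (.ifElse b p q) (k + 1) s Q := by
  by_cases hb : b.holds s
  · obtain ⟨t, ht, s', hr, hQ⟩ := hp hb
    exact ⟨t + 1, Nat.succ_le_succ ht, s', .ifTrue hb hr, hQ⟩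
  · obtain ⟨t, ht, s', hr, hQ⟩ := hq hb
    exact ⟨t + 1, Nat.succ_le_succ ht, s', .ifFalse hb hr, hQ⟩

/-- The first argument of the invariant `I` is a bound on the time spent so far. -/
theorem loop (I : ℕ → State → Prop) (B : ℕ) (start : I 0 s)
    (bound : ∀ t s', I t s' → t ≤ B)
    (step : ∀ t s', (Program.loop b p).Frame s s' → I t s' → b.holds s' →
      ∃ c, HaltsWithin p c s' (I (t + c + 1)))
    (finish : ∀ t s', (Program.loop b p).Frame s s' → I t s' → ¬ b.holds s' → Q s') :
    HaltsWithin (.loop b p) (B + 1) s Q := by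
  suffices from_time : ∀ m t s', B - t = m → (Program.loop b p).Frame s s' → I t s' →
      HaltsWithin (.loop b p) (B - t + 1) s' Q from from_time _ 0 s rfl (.refl _ _ _) start
  intro m
  induction m using Nat.strong_induction_on with
  | _ m ih =>
    intro t s' hm hF hI
    by_cases hb : b.holds s'
    · obtain ⟨c, t₁, ht₁, s₁, hr₁, hI₁⟩ := step t s' hF hI hb
      have hB := bound _ _ hI₁
      obtain ⟨t₂, ht₂, s₂, hr₂, hQ⟩ :=
        ih (B - (t + c + 1)) (by lia) _ s₁ rfl (hF.trans hr₁.frame) hI₁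
      exact ⟨t₁ + t₂ + 1, by lia, s₂, .loopStep hb hr₁ hr₂, hQ⟩
    · exact ⟨1, by lia, s', .loopDone hb, finish t s' hF hI hb⟩

end HaltsWithin

/-- The program that executes the given instructions one after the other. -/
def Program.block : List Instr → Program
  | [] => .skip
  | i :: l => .seq (.instr i) (Program.block l)

theorem HaltsWithin.block {l : List Instr} {s : State} {Q : State → Prop}
    (h : Q (l.foldl (fun s i => i.exec s) s)) :
    HaltsWithin (Program.block l) (l.length + 1) s Q := by
  induction l generalizing s with
  | nil => exact .skip h
  | cons i l ih =>
    have hi : HaltsWithin (.instr i) 1 s (· = i.exec s) := .instr rfl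
    exact (hi.seq fun s' _ hs' => ih (hs' ▸ h)).of_le (by simp [add_comm])

/-! ### Memory layout -/

-- Registers `0` and `1` and arrays `0`, `1` and `2` are prescribed by `inputState` and `Outputs`.
-- `Reg.zero` is never written to and so keeps its initial value `0`.
namespace Reg

abbrev size : ℕ := 0
abbrev count : ℕ := 1
abbrev root : ℕ := 2
abbrev head : ℕ := 3
abbrev tail : ℕ := 4
abbrev vertex : ℕ := 5
abbrev index : ℕ := 6
abbrev limit : ℕ := 7
abbrev nbr : ℕ := 8
abbrev val : ℕ := 9
abbrev zero : ℕ := 10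
abbrev parent : ℕ := 11
abbrev flag : ℕ := 12
abbrev one : ℕ := 13

end Reg

namespace Arr

abbrev offsets : ℕ := 0
abbrev neighbours : ℕ := 1
abbrev output : ℕ := 2
abbrev parent : ℕ := 3
abbrev queue : ℕ := 4
abbrev covered : ℕ := 5

end Arr

section Input

variable {n : ℕ} {G : SimpleGraph (Fin n)} {adj : Fin n → List (Fin n)}

/-- `s` holds the adjacency lists `adj` as in the initial memory, and the constant `0`. -/
structure StoresInput (adj : Fin n → List (Fin n)) (s : State) : Prop where
  size : s.reg Reg.size = n
  zero : s.reg Reg.zero = 0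
  offset_succ : ∀ v : Fin n,
    s.arr Arr.offsets (v + 1) = s.arr Arr.offsets v + (adj v).length
  neighbour : ∀ (v : Fin n) (i : ℕ) (hi : i < (adj v).length),
    s.arr Arr.neighbours (s.arr Arr.offsets v + i) = (adj v)[i]

theorem StoresInput.of_eqOutside {xs as : List ℕ} {s s' : State} (hin : StoresInput adj s)
    (hF : EqOutside xs as s s') (hx : ∀ x ∈ [Reg.size, Reg.zero], x ∉ xs := by decide)
    (ha : ∀ a ∈ [Arr.offsets, Arr.neighbours], a ∉ as := by decide) : StoresInput adj s' where
  size := (hF.reg _ (hx _ (by simp))).trans hin.size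
  zero := (hF.reg _ (hx _ (by simp))).trans hin.zero
  offset_succ := by
    rw [hF.arr _ (ha Arr.offsets (by simp))]
    exact hin.offset_succ
  neighbour := by
    rw [hF.arr _ (ha Arr.offsets (by simp)), hF.arr _ (ha Arr.neighbours (by simp))]
    exact hin.neighbour

theorem StoresInput.neighbour_append {s : State} {v x : Fin n} {l r : List (Fin n)}
    (hin : StoresInput adj s) (hl : adj v = l ++ x :: r) :
    s.arr Arr.neighbours (s.arr Arr.offsets v + l.length) = x := by
  rw [hin.neighbour v l.length (by simp [hl])]
  simp [hl]

theorem getElem?_flatten_length_take_add {α : Type*} (L : List (List α)) (k j : ℕ)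
    (hk : k < L.length) (hj : j < L[k].length) :
    L.flatten[(L.take k).flatten.length + j]? = some L[k][j] := by
  have hL : L = L.take k ++ L[k] :: L.drop (k + 1) := by simp
  conv_lhs => rw [hL]
  rw [List.flatten_append, List.flatten_cons]
  simp [List.getElem?_append, hj]

theorem storesInput_inputState (adj : Fin n → List (Fin n)) :
    StoresInput adj (inputState adj) where
  size := rfl
  zero := rfl
  offset_succ v := by
    have hv : (v : ℕ) < (List.ofFn adj).length := by simp
    simp only [inputState, if_true, ← List.take_concat_get' _ _ hv]
    simp
  neighbour v i hi := by
    have hget := getElem?_flatten_length_take_add (List.ofFn adj) v i (by simp) (by simpa using hi)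
    simp only [inputState, if_true, one_ne_zero, if_false, List.getElem?_map, hget]
    simp

theorem sum_length_adj (hadj : IsAdjacencyList G adj) :
    ∑ v, (adj v).length = 2 * G.edgeSet.ncard := by
  classical
  have hdegree (v : Fin n) : (adj v).length = G.degree v := by
    rw [← List.toFinset_card_of_nodup (hadj v).1, ← card_neighborFinset_eq_degree]
    congr 1
    ext u
    rw [List.mem_toFinset, (hadj v).2, mem_neighborFinset]
  simp_rw [hdegree]
  rw [sum_degrees_eq_twice_card_edges, ← coe_edgeFinset, Set.ncard_coe_finset]

theorem sum_mul_length_adj_add (hadj : IsAdjacencyList G adj) (a b : ℕ) :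
    ∑ v, (a * (adj v).length + b) = a * (2 * G.edgeSet.ncard) + n * b := by
  simp [Finset.sum_add_distrib, ← Finset.mul_sum, sum_length_adj hadj]

end Input

/-! ### Iterating over an adjacency list -/

/-- Execute `body` with the vertex stored at position `Reg.index` of `Arr.neighbours` in register
`Reg.nbr`, and advance `Reg.index`. -/
def nextNeighbour (body : Program) : Program :=
  .seq (.instr (.load Reg.nbr Arr.neighbours Reg.index))
    (.seq body (.instr (.succ Reg.index)))

/-- Set the registers `Reg.index` and `Reg.limit` to the first position of the adjacency list of the
vertex held in register `Reg.vertex` and to the first position after it. -/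
def loadBounds : Program :=
  .block [.load Reg.index Arr.offsets Reg.vertex, .copy Reg.limit Reg.vertex, .succ Reg.limit,
    .load Reg.limit Arr.offsets Reg.limit]

/-- Execute `body` for every vertex in the adjacency list of the vertex held in register
`Reg.vertex`, with the current entry of the list in register `Reg.nbr`. -/
def forNeighbours (body : Program) : Program :=
  .seq loadBounds (.loop (.lt Reg.index Reg.limit) (nextNeighbour body))

theorem nextNeighbour_spec {s : State} {body : Program} {c : ℕ} {Q : State → Prop}
    (hbody : ∀ s', EqOutside [Reg.nbr] [] s s' →
      s'.reg Reg.nbr = s.arr Arr.neighbours (s.reg Reg.index) → HaltsWithin body c s' Q)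
    (insensitive : ∀ s s', EqOutside [Reg.index] [] s s' → Q s → Q s')
    (hindex : Reg.index ∉ body.regs) :
    HaltsWithin (nextNeighbour body) (c + 2) s
      fun s' => s'.reg Reg.index = s.reg Reg.index + 1 ∧ Q s' := by
  have hload : HaltsWithin (.instr (.load Reg.nbr Arr.neighbours Reg.index)) 1 s
      fun s' => s'.reg Reg.nbr = s.arr Arr.neighbours (s.reg Reg.index) :=
    .instr (by simp)
  refine (hload.seq fun s₁ hF₁ hnbr => (hbody s₁ hF₁ hnbr).seq fun s₂ hF₂ hQ => .instr
    ⟨?_, insensitive s₂ _ (Instr.eqOutside_exec (.succ Reg.index) s₂) hQ⟩).of_le (by lia)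
  simp [hF₂.reg Reg.index hindex, hF₁.reg Reg.index (by decide)]

theorem loadBounds_spec {n : ℕ} {adj : Fin n → List (Fin n)} {v : Fin n} {s : State}
    (hin : StoresInput adj s) (hv : s.reg Reg.vertex = v) :
    HaltsWithin loadBounds 5 s fun s' => s'.reg Reg.index = s.arr Arr.offsets v ∧
      s'.reg Reg.limit = s.arr Arr.offsets v + (adj v).length :=
  .block (by simp [hv, hin.offset_succ])

/-- `J l` is an invariant that holds after the entries in the initial segment `l` of the adjacency
list have been processed. -/
theorem forNeighbours_spec {n : ℕ} {adj : Fin n → List (Fin n)} {v : Fin n} {s : State}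
    {body : Program} {c : ℕ} (hin : StoresInput adj s) (hv : s.reg Reg.vertex = v)
    (J : List (Fin n) → State → Prop)
    (insensitive : ∀ l s s', EqOutside [Reg.index, Reg.limit, Reg.nbr] [] s s' → J l s → J l s')
    (start : J [] s)
    (step : ∀ l x s', (forNeighbours body).Frame s s' → x ∈ adj v → s'.reg Reg.nbr = x →
      J l s' → HaltsWithin body c s' (J (l ++ [x])))
    (hregs : ∀ x ∈ [Reg.index, Reg.limit], x ∉ body.regs := by decide)
    (harrs : ∀ a ∈ [Arr.offsets, Arr.neighbours], a ∉ body.arrs := by decide) :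
    HaltsWithin (forNeighbours body) ((c + 3) * (adj v).length + 6) s (J (adj v)) := by
  have hindex_regs : Reg.index ∉ body.regs := hregs _ (by simp)
  have hlimit_regs : Reg.limit ∉ (nextNeighbour body).regs := by
    simp [nextNeighbour, Program.regs, Instr.regs, hregs Reg.limit]
  have hneighbours_arrs : Arr.neighbours ∉ (forNeighbours body).arrs := by
    simp [forNeighbours, loadBounds, nextNeighbour, Program.block, Program.arrs, Instr.arrs,
      harrs Arr.neighbours]
  let I (t : ℕ) (s' : State) : Prop := ∃ l r, adj v = l ++ r ∧
    s'.reg Reg.index = s.arr Arr.offsets v + l.length ∧ J l s' ∧ t ≤ (c + 3) * l.length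
  refine ((loadBounds_spec hin hv).seq fun s₁ hF₁ ⟨hindex, hlimit⟩ =>
    HaltsWithin.loop I ((c + 3) * (adj v).length)
      ⟨[], adj v, rfl, by simp [hindex],
        insensitive _ s _ (hF₁.mono (by decide) (by decide)) start, by simp⟩
      ?_ ?_ ?_).of_le (by lia)
  · rintro t s' ⟨l, r, hl, -, -, ht⟩
    exact ht.trans (Nat.mul_le_mul_left _ (by simp [hl]))
  · rintro t s₂ hF₂ ⟨l, r, hl, hi, hJ, ht⟩ hlt
    have hF : (forNeighbours body).Frame s s₂ :=
      (hF₁.mono (List.subset_append_left _ _) (List.subset_append_left _ _)).trans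
        (hF₂.mono (List.subset_append_right _ _) (List.subset_append_right _ _))
    obtain ⟨x, r, rfl⟩ : ∃ x r', r = x :: r' := by
      rw [← List.length_pos_iff_exists_cons]
      simpa [hi, hF₂.reg _ hlimit_regs, hlimit, hl] using hlt
    have hx : s₂.arr Arr.neighbours (s₂.reg Reg.index) = x := by
      rw [hi, hF.arr _ hneighbours_arrs, hin.neighbour_append hl]
    refine ⟨c + 2, (nextNeighbour_spec (Q := J (l ++ [x])) (fun s₃ hF₃ hnbr => ?_)
      (fun s s' hF => insensitive _ s s' (hF.mono (by simp) (by simp))) hindex_regs).mono le_rfl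
      fun s' _ ⟨hi', hJ'⟩ => ⟨l ++ [x], r, by simp [hl], by simp [hi', hi, add_assoc], hJ', ?_⟩⟩
    · have hnbr_regs : [Reg.nbr] ⊆ (forNeighbours body).regs := by
        simp [forNeighbours, nextNeighbour, Program.regs, Instr.regs]
      exact step l x s₃ (hF.trans (hF₃.mono hnbr_regs (by simp))) (by simp [hl])
        (hnbr.trans hx) (insensitive _ s₂ _ (hF₃.mono (by simp) (by simp)) hJ)
    · rw [List.length_append, List.length_singleton, mul_add]
      lia
  · rintro t s₂ hF₂ ⟨l, r, hl, hi, hJ, -⟩ hlt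
    have hr : r = [] := by
      simpa [hi, hF₂.reg _ hlimit_regs, hlimit, hl] using hlt
    rwa [hl, hr, List.append_nil]

/-! ### The search program -/

/-- Append the undiscovered vertex held in register `x` to the queue and record its parent, which
is expected, increased by one, in register `Reg.parent`. -/
def enqueue (x : ℕ) : Program :=
  .block [.store Arr.parent x Reg.parent, .store Arr.queue Reg.tail x, .succ Reg.tail]

/-- Enqueue the vertex held in register `Reg.nbr` unless it has been discovered before. -/
def discover : Program :=
  .seq (.instr (.load Reg.val Arr.parent Reg.nbr))
    (.ifElse (.eq Reg.val Reg.zero) (enqueue Reg.nbr) .skip)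

/-- Remove the first vertex from the queue and discover its neighbours. -/
def visit : Program :=
  .seq (.block [.load Reg.vertex Arr.queue Reg.head, .copy Reg.parent Reg.vertex,
      .succ Reg.parent])
    (.seq (forNeighbours discover) (.instr (.succ Reg.head)))

/-- Enqueue the vertex held in register `Reg.root` as the root of a new component, or advance
`Reg.root` if this vertex has been discovered before. -/
def tryRoot : Program :=
  .seq (.instr (.load Reg.val Arr.parent Reg.root))
    (.ifElse (.eq Reg.val Reg.zero)
      (.seq (.block [.copy Reg.parent Reg.root, .succ Reg.parent]) (enqueue Reg.root))
      (.instr (.succ Reg.root)))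

/-- Breadth-first search of all components. A vertex that leaves the queue stays in `Arr.queue`, so
that this array finally lists all vertices in the order of their discovery. -/
def breadthFirstSearch : Program :=
  .loop (.lt Reg.root Reg.size) (.ifElse (.lt Reg.head Reg.tail) visit tryRoot)

section BreadthFirstSearch

variable {n : ℕ} {G : SimpleGraph (Fin n)} {adj : Fin n → List (Fin n)} {l : List (Fin n)} {h : ℕ}
  {p : Fin n → Fin n} {s : State}

/-- `s` holds the list `l` of discovered vertices and their parents. The entry of `Arr.parent` at a
discovered vertex is the parent increased by one, since `0` marks the undiscovered vertices. -/
structure StoresSearch (l : List (Fin n)) (p : Fin n → Fin n) (s : State) : Prop where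
  tail : s.reg Reg.tail = l.length
  queue : ∀ (i : ℕ) (hi : i < l.length), s.arr Arr.queue i = l[i]
  parent : ∀ v ∈ l, s.arr Arr.parent v = p v + 1
  undiscovered : ∀ v ∉ l, s.arr Arr.parent v = 0

theorem StoresSearch.of_eqOutside {xs as : List ℕ} {s' : State} (hs : StoresSearch l p s)
    (hF : EqOutside xs as s s') (hx : Reg.tail ∉ xs := by decide)
    (ha : ∀ a ∈ [Arr.queue, Arr.parent], a ∉ as := by decide) : StoresSearch l p s' where
  tail := (hF.reg _ hx).trans hs.tail
  queue := hF.arr _ (ha Arr.queue (by simp)) ▸ hs.queue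
  parent := hF.arr _ (ha Arr.parent (by simp)) ▸ hs.parent
  undiscovered := hF.arr _ (ha Arr.parent (by simp)) ▸ hs.undiscovered

theorem StoresSearch.parent_eq_zero_iff (hs : StoresSearch l p s) (v : Fin n) :
    s.arr Arr.parent v = 0 ↔ v ∉ l :=
  ⟨fun h0 hv => by simp [hs.parent v hv] at h0, hs.undiscovered v⟩

theorem storesSearch_inputState (p : Fin n → Fin n) : StoresSearch [] p (inputState adj) where
  tail := rfl
  queue := by simp
  parent := by simp
  undiscovered _ _ := rfl

theorem enqueue_spec {r : ℕ} {x u : Fin n} (hs : StoresSearch l p s) (hr : s.reg r = x)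
    (hx : x ∉ l) (hu : s.reg Reg.parent = u + 1) :
    HaltsWithin (enqueue r) 4 s (StoresSearch (l ++ [x]) (Function.update p x u)) := by
  refine .block ⟨?_, fun i hi => ?_, fun v hv => ?_, fun v hv => ?_⟩
  · simp [hs.tail]
  · rcases (Nat.lt_succ_iff.1 (by simpa using hi)).lt_or_eq with hi | rfl
    · simp [hs.tail, hi.ne, hi, hs.queue i hi]
    · simp [hs.tail, hr]
  · rcases eq_or_ne v x with rfl | hvx
    · simp [hr, hu]
    · have hvl : v ∈ l := by simpa [hvx] using hv
      simp [hr, Fin.val_inj, hvx, hs.parent v hvl]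
  · have hvx : v ≠ x ∧ v ∉ l := by simpa [and_comm] using hv
    simp [hr, Fin.val_inj, hvx.1, hs.undiscovered v hvx.2]

theorem discover_spec {x u : Fin n} (hin : StoresInput adj s) (hs : StoresSearch l p s)
    (hS : SearchState G l h p) (hu : l[h]? = some u) (hux : G.Adj u x) (hx : s.reg Reg.nbr = x)
    (hparent : s.reg Reg.parent = u + 1) :
    HaltsWithin discover 6 s fun s' => ∃ l' p', l <+: l' ∧ x ∈ l' ∧ SearchState G l' h p' ∧
      StoresSearch l' p' s' := by
  have hload : HaltsWithin (.instr (.load Reg.val Arr.parent Reg.nbr)) 1 s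
      fun s' => s'.reg Reg.val = s'.reg Reg.zero ↔ x ∉ l :=
    .instr (by simp [hx, hin.zero, hs.parent_eq_zero_iff])
  refine hload.seq fun s₁ hF₁ hval => HaltsWithin.ifElse (k := 4) (fun hb => ?_) fun hb => ?_
  · have hxl : x ∉ l := hval.1 hb
    refine (enqueue_spec (hs.of_eqOutside hF₁) ((hF₁.reg _ (by decide)).trans hx) hxl
      ((hF₁.reg _ (by decide)).trans hparent)).mono le_rfl fun s₂ _ hs₂ =>
        ⟨_, _, List.prefix_append l [x], by simp, hS.discover hxl (fun v hv => ?_) ?_ ?_, hs₂⟩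
    · exact Function.update_of_ne (ne_of_mem_of_not_mem hv hxl) _ _
    · rw [Function.update_self,
        List.getElem?_append_left (List.getElem?_eq_some_iff.1 hu).1, hu]
    · exact .inr (by rwa [Function.update_self])
  · exact (HaltsWithin.skip ⟨l, p, List.prefix_rfl, not_not.1 (mt hval.2 hb), hS,
      hs.of_eqOutside hF₁⟩).of_le (by lia)

theorem visit_spec {u : Fin n} (hadj : IsAdjacencyList G adj) (hin : StoresInput adj s)
    (hs : StoresSearch l p s) (hS : SearchState G l h p) (hhead : s.reg Reg.head = h)
    (hu : l[h]? = some u) :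
    HaltsWithin visit (9 * (adj u).length + 11) s fun s' => ∃ l' p', l <+: l' ∧
      SearchState G l' (h + 1) p' ∧ StoresSearch l' p' s' ∧ s'.reg Reg.head = h + 1 := by
  obtain ⟨hh, hlu⟩ := List.getElem?_eq_some_iff.1 hu
  have hhead_mem {l' : List (Fin n)} (hl : l <+: l') : l'[h]? = some u :=
    hlu ▸ List.prefix_iff_getElem?.1 hl h hh
  have hload : HaltsWithin (.block [.load Reg.vertex Arr.queue Reg.head,
      .copy Reg.parent Reg.vertex, .succ Reg.parent]) 4 s
      fun s' => s'.reg Reg.vertex = u ∧ s'.reg Reg.parent = u + 1 :=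
    .block (by simp [hhead, hs.queue h hh, hlu])
  have hscan (s₁ : State) (hF₁ : EqOutside [Reg.vertex, Reg.parent] [] s s₁)
      (hvertex : s₁.reg Reg.vertex = u) (hparent : s₁.reg Reg.parent = u + 1) :
      HaltsWithin (forNeighbours discover) (9 * (adj u).length + 6) s₁ fun s' => ∃ l' p',
        l <+: l' ∧ (∀ x ∈ adj u, x ∈ l') ∧ SearchState G l' h p' ∧ StoresSearch l' p' s' := by
    have hin₁ := hin.of_eqOutside hF₁
    refine forNeighbours_spec hin₁ hvertex (fun a s' => ∃ l' p', l <+: l' ∧ (∀ x ∈ a, x ∈ l') ∧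
      SearchState G l' h p' ∧ StoresSearch l' p' s') ?_ ?_ ?_
    · rintro a s₂ s₃ hF ⟨l', p', hl, ha, hS', hs'⟩
      exact ⟨l', p', hl, ha, hS', hs'.of_eqOutside hF⟩
    · exact ⟨l, p, List.prefix_rfl, by simp, hS, hs.of_eqOutside hF₁⟩
    · rintro a x s₂ hF hx hnbr ⟨l', p', hl, ha, hS', hs'⟩
      refine (discover_spec (hin₁.of_eqOutside hF) hs' hS' (hhead_mem hl)
        (((hadj u).2 x).1 hx) hnbr ((hF.reg _ (by decide)).trans hparent)).mono le_rfl ?_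
      rintro s₃ - ⟨l'', p'', hl', hx', hS'', hs''⟩
      refine ⟨l'', p'', hl.trans hl', fun y hy => ?_, hS'', hs''⟩
      rcases List.mem_append.1 hy with hy | hy
      · exact hl'.subset (ha y hy)
      · rwa [List.mem_singleton.1 hy]
  refine (hload.seq fun s₁ hF₁ ⟨hvertex, hparent⟩ =>
    (hscan s₁ (hF₁.mono (by decide) (by decide)) hvertex hparent).seq fun s₂ hF₂
      ⟨l', p', hl, hall, hS', hs'⟩ => .instr ⟨l', p', hl, ?_, ?_, ?_⟩).of_le (by lia)
  · exact hS'.advance (hhead_mem hl) fun x hux => hall x (((hadj u).2 x).2 hux)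
  · exact hs'.of_eqOutside (Instr.eqOutside_exec _ _)
  · simp [hF₂.reg Reg.head (by decide), hF₁.reg Reg.head (by decide), hhead]

theorem tryRoot_spec_of_mem {x : Fin n} (hin : StoresInput adj s) (hs : StoresSearch l p s)
    (hroot : s.reg Reg.root = x) (hx : x ∈ l) :
    HaltsWithin tryRoot 3 s fun s' => StoresSearch l p s' ∧ s'.reg Reg.root = x + 1 := by
  have hload : HaltsWithin (.instr (.load Reg.val Arr.parent Reg.root)) 1 s
      fun s' => s'.reg Reg.val ≠ s'.reg Reg.zero :=
    .instr (by simp [hroot, hin.zero, hs.parent_eq_zero_iff, hx])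
  refine hload.seq fun s₁ hF₁ hval => HaltsWithin.ifElse (fun hb => absurd hb ?_) fun _ =>
    .instr ⟨(hs.of_eqOutside hF₁).of_eqOutside (Instr.eqOutside_exec _ _), ?_⟩
  · exact hval
  · simp [hF₁.reg Reg.root (by decide), hroot]

theorem tryRoot_spec_of_notMem {x : Fin n} (hin : StoresInput adj s) (hs : StoresSearch l p s)
    (hroot : s.reg Reg.root = x) (hx : x ∉ l) :
    HaltsWithin tryRoot 9 s fun s' => StoresSearch (l ++ [x]) (Function.update p x x) s' ∧
      s'.reg Reg.root = x := by
  have hload : HaltsWithin (.instr (.load Reg.val Arr.parent Reg.root)) 1 s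
      fun s' => s'.reg Reg.val = s'.reg Reg.zero :=
    .instr (by simp [hroot, hin.zero, hs.undiscovered x hx])
  have hset (s₁ : State) (hroot₁ : s₁.reg Reg.root = x) :
      HaltsWithin (.block [.copy Reg.parent Reg.root, .succ Reg.parent]) 3 s₁
        fun s' => s'.reg Reg.parent = x + 1 :=
    .block (by simp [hroot₁])
  refine hload.seq fun s₁ hF₁ hval => HaltsWithin.ifElse (k := 7) (fun _ => ?_)
    fun hb => absurd ?_ hb
  swap
  · exact hval
  have hroot₁ : s₁.reg Reg.root = x := (hF₁.reg _ (by decide)).trans hroot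
  refine (hset s₁ hroot₁).seq (k' := 4) fun s₂ hF₂ hparent => ?_
  have hroot₂ : s₂.reg Reg.root = x := (hF₂.reg _ (by decide)).trans hroot₁
  exact (enqueue_spec ((hs.of_eqOutside hF₁).of_eqOutside hF₂) hroot₂ hx hparent).mono le_rfl
    fun s₃ hF₃ hs₃ => ⟨hs₃, (hF₃.reg _ (by decide)).trans hroot₂⟩

/-- The loop invariant of `breadthFirstSearch`: after `t` steps the memory `s` holds the state
`l`, `h`, `p` of the search, and every vertex below `Reg.root` has been discovered. The summands of
the bound on `t` pay for the visited vertices, the discoveries and the increments of `Reg.root`. -/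
structure SearchInvariant (G : SimpleGraph (Fin n)) (adj : Fin n → List (Fin n))
    (l : List (Fin n)) (h : ℕ) (p : Fin n → Fin n) (t : ℕ) (s : State) : Prop where
  searchState : SearchState G l h p
  stores : StoresSearch l p s
  head : s.reg Reg.head = h
  root_le : s.reg Reg.root ≤ n
  mem_of_lt_root : ∀ v : Fin n, v < s.reg Reg.root → v ∈ l
  head_eq : s.reg Reg.root = n → h = l.length
  time_le : t ≤ ((l.take h).map fun v => 9 * (adj v).length + 13).sum + 11 * l.length +
    5 * s.reg Reg.root

theorem sum_map_le_sum_univ {α : Type*} [Fintype α] {l : List α} (hl : l.Nodup) (f : α → ℕ) :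
    (l.map f).sum ≤ ∑ v, f v := by
  classical
  rw [← List.sum_toFinset f hl]
  exact Finset.sum_le_univ_sum_of_nonneg fun _ => Nat.zero_le _

theorem SearchInvariant.time_le_const {t : ℕ} (hI : SearchInvariant G adj l h p t s) :
    t ≤ ∑ v, (9 * (adj v).length + 13) + 16 * n := by
  have hnodup : l.Nodup := hI.searchState.nodup
  have hsum := sum_map_le_sum_univ (hnodup.sublist (List.take_sublist h l))
    fun v => 9 * (adj v).length + 13
  have hlength : l.length ≤ n := by simpa using hnodup.length_le_card
  linarith [hI.time_le, hI.root_le]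

theorem SearchInvariant.visit {t : ℕ} (hI : SearchInvariant G adj l h p t s)
    (hadj : IsAdjacencyList G adj) (hin : StoresInput adj s) (hroot : s.reg Reg.root < n)
    (hh : h < l.length) :
    HaltsWithin visit (9 * (adj l[h]).length + 11) s fun s' => ∃ l' p',
      SearchInvariant G adj l' (h + 1) p' (t + (9 * (adj l[h]).length + 12) + 1) s' := by
  refine (visit_spec hadj hin hI.stores hI.searchState hI.head
    (List.getElem?_eq_getElem hh)).mono le_rfl ?_
  rintro s' hF ⟨l', p', hl, hS', hs', hhead⟩
  have hroot' : s'.reg Reg.root = s.reg Reg.root := hF.reg _ (by decide)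
  refine ⟨l', p', hS', hs', hhead, hroot' ▸ hI.root_le, fun v hv =>
    hl.subset (hI.mem_of_lt_root v (hroot' ▸ hv)), fun hn => absurd hn (by lia), ?_⟩
  have htake : l'.take (h + 1) = l.take h ++ [l[h]] := by
    obtain ⟨a, rfl⟩ := hl
    rw [List.take_append_of_le_length hh, List.take_concat_get']
  rw [htake, hroot', List.map_append, List.sum_append, List.map_singleton, List.sum_singleton]
  linarith [hI.time_le, hl.length_le]

theorem SearchInvariant.tryRoot_of_mem {t : ℕ} {x : Fin n}
    (hI : SearchInvariant G adj l l.length p t s) (hin : StoresInput adj s)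
    (hroot : s.reg Reg.root = x) (hx : x ∈ l) :
    HaltsWithin tryRoot 3 s (SearchInvariant G adj l l.length p (t + 4 + 1)) := by
  refine (tryRoot_spec_of_mem hin hI.stores hroot hx).mono le_rfl fun s' hF ⟨hs', hroot'⟩ =>
    ⟨hI.searchState, hs', (hF.reg _ (by decide)).trans hI.head, hroot' ▸ x.2, fun v hv => ?_,
      fun _ => rfl, ?_⟩
  · rcases eq_or_ne v x with rfl | hvx
    · exact hx
    · exact hI.mem_of_lt_root v (by lia)
  · linarith [hI.time_le]

theorem SearchInvariant.tryRoot_of_notMem {t : ℕ} {x : Fin n}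
    (hI : SearchInvariant G adj l l.length p t s) (hin : StoresInput adj s)
    (hroot : s.reg Reg.root = x) (hx : x ∉ l) :
    HaltsWithin tryRoot 9 s (SearchInvariant G adj (l ++ [x]) l.length (Function.update p x x)
      (t + 10 + 1)) := by
  refine (tryRoot_spec_of_notMem hin hI.stores hroot hx).mono le_rfl fun s' hF ⟨hs', hroot'⟩ =>
    ⟨hI.searchState.discover hx (fun v hv => ?_) ?_ ?_, hs',
      (hF.reg _ (by decide)).trans hI.head, hroot' ▸ x.2.le, fun v hv => ?_,
      fun hn => absurd hn (hroot' ▸ x.2.ne), ?_⟩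
  · exact Function.update_of_ne (ne_of_mem_of_not_mem hv hx) _ _
  · simp
  · exact .inl (Function.update_self _ _ _)
  · exact List.mem_append_left _ (hI.mem_of_lt_root v (by rwa [hroot, ← hroot']))
  · have ht := hI.time_le
    rw [hroot] at ht
    rw [hroot', List.take_left, List.length_append, List.length_singleton]
    rw [List.take_length] at ht
    lia

theorem breadthFirstSearch_spec (hadj : IsAdjacencyList G adj) :
    HaltsWithin breadthFirstSearch (∑ v, (9 * (adj v).length + 13) + 16 * n + 1) (inputState adj)
      fun s' => ∃ l p, SearchState G l l.length p ∧ (∀ v, v ∈ l) ∧ StoresSearch l p s' ∧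
        s'.reg Reg.head = l.length := by
  refine .loop (fun t s' => ∃ l h p, SearchInvariant G adj l h p t s') _ ?_ ?_ ?_ ?_
  · exact ⟨[], 0, id, .nil _, storesSearch_inputState _, rfl, Nat.zero_le _,
      fun v hv => absurd hv (Nat.not_lt_zero _), fun _ => rfl, Nat.zero_le _⟩
  · rintro t s' ⟨l, h, p, hI⟩
    exact hI.time_le_const
  · rintro t s' hF ⟨l, h, p, hI⟩ hlt
    have hin : StoresInput adj s' := (storesInput_inputState adj).of_eqOutside hF
    have hroot : s'.reg Reg.root < n := hin.size ▸ hlt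
    by_cases hh : h < l.length
    · exact ⟨_, .ifElse (fun _ => (hI.visit hadj hin hroot hh).mono le_rfl
        fun s'' _ ⟨l', p', hI'⟩ => ⟨l', _, p', hI'⟩)
        fun hb => absurd (by simpa [hI.head, hI.stores.tail] using hh) hb⟩
    obtain rfl : h = l.length := hI.searchState.head_le.antisymm (not_lt.1 hh)
    have hempty : ¬ (Test.lt Reg.head Reg.tail).holds s' := by simp [hI.head, hI.stores.tail]
    by_cases hx : (⟨s'.reg Reg.root, hroot⟩ : Fin n) ∈ l
    · exact ⟨_, .ifElse (fun hb => absurd hb hempty) fun _ =>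
        (hI.tryRoot_of_mem hin rfl hx).mono le_rfl fun s'' _ hI' => ⟨_, _, _, hI'⟩⟩
    · exact ⟨_, .ifElse (fun hb => absurd hb hempty) fun _ =>
        (hI.tryRoot_of_notMem hin rfl hx).mono le_rfl fun s'' _ hI' => ⟨_, _, _, hI'⟩⟩
  · rintro t s' hF ⟨l, h, p, hI⟩ hguard
    have hin : StoresInput adj s' := (storesInput_inputState adj).of_eqOutside hF
    have hroot : s'.reg Reg.root = n := hI.root_le.antisymm (not_lt.1 (hin.size ▸ hguard))
    obtain rfl := hI.head_eq hroot
    exact ⟨l, p, hI.searchState, fun v => hI.mem_of_lt_root v (hroot ▸ v.2), hI.stores, hI.head⟩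

end BreadthFirstSearch

/-! ### The selection program -/

/-- Set `Reg.flag` if the vertex held in `Reg.nbr` is uncovered and differs from the one in
`Reg.parent`. -/
def checkNeighbour : Program :=
  .seq (.instr (.load Reg.val Arr.covered Reg.nbr))
    (.ifElse (.eq Reg.val Reg.zero)
      (.ifElse (.eq Reg.nbr Reg.parent) .skip (.instr (.const Reg.flag 1))) .skip)

/-- Move `Reg.head` to the previous vertex of the queue, load this vertex and its parent, and set
`Reg.flag` to `1` or `0` according to whether the vertex needs its parent. -/
def testPrevious : Program :=
  .seq (.block [.pred Reg.head, .load Reg.vertex Arr.queue Reg.head,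
      .load Reg.parent Arr.parent Reg.vertex, .pred Reg.parent, .const Reg.flag 0,
      .load Reg.val Arr.covered Reg.vertex])
    (.ifElse (.eq Reg.val Reg.zero) (forNeighbours checkNeighbour) .skip)

/-- Append the vertex held in `Reg.parent` to the output, and mark it and its neighbours as
covered. -/
def select : Program :=
  .seq (.block [.store Arr.output Reg.count Reg.parent, .succ Reg.count,
      .copy Reg.vertex Reg.parent, .const Reg.one 1, .store Arr.covered Reg.vertex Reg.one])
    (forNeighbours (.instr (.store Arr.covered Reg.nbr Reg.one)))

/-- Perform the greedy step for the previous vertex of the queue. -/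
def treatPrevious : Program :=
  .seq testPrevious (.ifElse (.eq Reg.flag Reg.zero) .skip select)

/-- The greedy algorithm, which treats the vertices in reverse order of their discovery. -/
def greedySelection : Program :=
  .loop (.lt Reg.zero Reg.head) treatPrevious

section GreedySelection

variable {n : ℕ} {G : SimpleGraph (Fin n)} {adj : Fin n → List (Fin n)} {l : List (Fin n)} {k : ℕ}
  {p : Fin n → Fin n} {s : State} {S : Finset (Fin n)} {v : Fin n}

/-- `s` lists the set `S` as output, and the nonzero entries of `Arr.covered` mark the vertices
that `S` covers. -/
structure StoresSelection (G : SimpleGraph (Fin n)) (S : Finset (Fin n)) (s : State) : Prop where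
  outputs : Outputs s S
  covered_eq_zero_iff : ∀ v : Fin n, s.arr Arr.covered v = 0 ↔ ¬ Covered G S v

theorem StoresSelection.of_eqOutside {xs as : List ℕ} {s' : State} (hs : StoresSelection G S s)
    (hF : EqOutside xs as s s') (hx : Reg.count ∉ xs := by decide)
    (ha : ∀ a ∈ [Arr.output, Arr.covered], a ∉ as := by decide) : StoresSelection G S s' where
  outputs := by
    rw [Outputs, hF.reg 1 hx, hF.arr 2 (ha Arr.output (by simp))]
    exact hs.outputs
  covered_eq_zero_iff := hF.arr _ (ha Arr.covered (by simp)) ▸ hs.covered_eq_zero_iff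

theorem storesSelection_empty (hcount : s.reg Reg.count = 0)
    (hcovered : ∀ v : Fin n, s.arr Arr.covered v = 0) : StoresSelection G ∅ s where
  outputs := by simp_all [Outputs]
  covered_eq_zero_iff v := by simp [Covered, hcovered v]

theorem Outputs.insert {s' : State} {u : Fin n} (hs : Outputs s S) (hu : u ∉ S)
    (hcount : s'.reg Reg.count = s.reg Reg.count + 1)
    (houtput : ∀ i, s'.arr Arr.output i = if i = s.reg Reg.count then (u : ℕ)
      else s.arr Arr.output i) : Outputs s' (insert u S) := by
  refine ⟨by rw [Finset.card_insert_of_notMem hu, ← hs.1, hcount], fun v => ?_⟩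
  rw [Finset.mem_insert, hs.2, hcount]
  constructor
  · rintro (rfl | ⟨i, hi, hiv⟩)
    · exact ⟨s.reg Reg.count, Nat.lt_succ_self _, by simp [houtput]⟩
    · exact ⟨i, hi.trans (Nat.lt_succ_self _), by simp [houtput, hi.ne, hiv]⟩
  · rintro ⟨i, hi, hiv⟩
    rw [houtput] at hiv
    split_ifs at hiv with hi'
    · exact .inl (Fin.ext hiv.symm)
    · exact .inr ⟨i, by lia, hiv⟩

theorem checkNeighbour_spec {x u : Fin n} (hin : StoresInput adj s) (hs : StoresSelection G S s)
    (hx : s.reg Reg.nbr = x) (hu : s.reg Reg.parent = u) :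
    HaltsWithin checkNeighbour 4 s fun s' =>
      s'.reg Reg.flag = 0 ↔ s.reg Reg.flag = 0 ∧ (x ≠ u → Covered G S x) := by
  have hload : HaltsWithin (.instr (.load Reg.val Arr.covered Reg.nbr)) 1 s
      fun s' => s'.reg Reg.val = s'.reg Reg.zero ↔ ¬ Covered G S x :=
    .instr (by simp [hx, hin.zero, hs.covered_eq_zero_iff])
  refine hload.seq (k' := 3) fun s₁ hF₁ hval => .ifElse (k := 2) (fun hb => ?_) fun hb => ?_
  · have hcov : ¬ Covered G S x := hval.1 hb
    have hnbr : s₁.reg Reg.nbr = s₁.reg Reg.parent ↔ x = u := by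
      rw [hF₁.reg _ (by decide), hF₁.reg _ (by decide), hx, hu, Fin.val_inj]
    refine .ifElse (fun hb => .skip ?_) fun hb => .instr ?_
    · simp [hF₁.reg Reg.flag (by decide), hnbr.1 hb]
    · simp [mt hnbr.2 hb, hcov]
  · have hcov : Covered G S x := not_not.1 (mt hval.2 hb)
    exact (HaltsWithin.skip (by simp [hF₁.reg Reg.flag (by decide), hcov])).of_le (by lia)

theorem forNeighbours_checkNeighbour_spec {u : Fin n} (hadj : IsAdjacencyList G adj)
    (hin : StoresInput adj s) (hs : StoresSelection G S s) (hv : s.reg Reg.vertex = v)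
    (hu : s.reg Reg.parent = u) (hflag : s.reg Reg.flag = 0) :
    HaltsWithin (forNeighbours checkNeighbour) (7 * (adj v).length + 6) s fun s' =>
      s'.reg Reg.flag = 0 ↔ ∀ x, G.Adj v x → x ≠ u → Covered G S x := by
  refine (forNeighbours_spec hin hv (fun a s' => s'.reg Reg.flag = 0 ↔
    ∀ x ∈ a, x ≠ u → Covered G S x) ?_ ?_ ?_).mono le_rfl fun s' _ hflag' => ?_
  · intro a s₁ s₂ hF hflag₁
    rwa [hF.reg Reg.flag (by decide)]
  · simpa using hflag
  · intro a x s₁ hF _ hnbr hflag₁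
    refine (checkNeighbour_spec (hin.of_eqOutside hF) (hs.of_eqOutside hF) hnbr
      ((hF.reg _ (by decide)).trans hu)).mono le_rfl fun s₂ _ hflag₂ => ?_
    simp only [hflag₂, hflag₁, List.forall_mem_append, List.forall_mem_singleton]
  · simp only [hflag', (hadj v).2]

theorem testPrevious_spec (hadj : IsAdjacencyList G adj) (hin : StoresInput adj s)
    (hsearch : StoresSearch l p s) (hs : StoresSelection G S s) (hhead : s.reg Reg.head = k + 1)
    (hv : l[k]? = some v) :
    HaltsWithin testPrevious (7 * (adj v).length + 14) s fun s' =>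
      (s'.reg Reg.flag = 0 ↔ ¬ NeedsParent G p S v) ∧ s'.reg Reg.head = k ∧
        s'.reg Reg.parent = p v := by
  obtain ⟨hk, hlv⟩ := List.getElem?_eq_some_iff.1 hv
  have hload : HaltsWithin (.block [.pred Reg.head, .load Reg.vertex Arr.queue Reg.head,
      .load Reg.parent Arr.parent Reg.vertex, .pred Reg.parent, .const Reg.flag 0,
      .load Reg.val Arr.covered Reg.vertex]) 7 s fun s' => s'.reg Reg.head = k ∧
        s'.reg Reg.vertex = v ∧ s'.reg Reg.parent = p v ∧ s'.reg Reg.flag = 0 ∧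
        (s'.reg Reg.val = s'.reg Reg.zero ↔ ¬ Covered G S v) :=
    .block (by simp [hhead, hsearch.queue k hk, hlv, hsearch.parent v (hlv ▸ l.getElem_mem hk),
      hin.zero, hs.covered_eq_zero_iff])
  refine (hload.seq (k' := 7 * (adj v).length + 7) fun s₁ hF₁ ⟨hhead₁, hvertex, hparent, hflag,
    hval⟩ => .ifElse (k := 7 * (adj v).length + 6) (fun hb => ?_) fun hb => ?_).of_le (by lia)
  · have hcov : ¬ Covered G S v := hval.1 hb
    refine (forNeighbours_checkNeighbour_spec hadj (hin.of_eqOutside hF₁) (hs.of_eqOutside hF₁)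
      hvertex hparent hflag).mono le_rfl fun s₂ hF₂ hflag₂ =>
        ⟨?_, (hF₂.reg _ (by decide)).trans hhead₁, (hF₂.reg _ (by decide)).trans hparent⟩
    rw [hflag₂, NeedsParent]
    simp [hcov, NonparentAdj]
  · have hcov : Covered G S v := not_not.1 (mt hval.2 hb)
    exact (HaltsWithin.skip ⟨by simp [hflag, NeedsParent, hcov], hhead₁, hparent⟩).of_le (by lia)

theorem select_spec {u : Fin n} (hadj : IsAdjacencyList G adj) (hin : StoresInput adj s)
    (hs : StoresSelection G S s) (hu : s.reg Reg.parent = u) (huS : u ∉ S) :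
    HaltsWithin select (4 * (adj u).length + 12) s (StoresSelection G (insert u S)) := by
  have houtput : HaltsWithin (.block [.store Arr.output Reg.count Reg.parent, .succ Reg.count,
      .copy Reg.vertex Reg.parent, .const Reg.one 1, .store Arr.covered Reg.vertex Reg.one]) 6 s
      fun s' => s'.reg Reg.vertex = u ∧ s'.reg Reg.one = 1 ∧ Outputs s' (insert u S) ∧
        ∀ x : Fin n, s'.arr Arr.covered x = 0 ↔ u ≠ x ∧ ¬ Covered G S x := by
    refine .block ⟨by simp [hu], by simp, hs.outputs.insert huS (by simp) (by simp [hu]),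
      fun x => ?_⟩
    by_cases hxu : x = u <;>
      simp [hu, ← hs.covered_eq_zero_iff, Fin.val_inj, hxu, eq_comm (a := u)]
  refine (houtput.seq (k' := 4 * (adj u).length + 6)
    fun s₁ hF₁ ⟨hvertex, hone, hout, hcov⟩ => ?_).of_le (by lia)
  refine (forNeighbours_spec (c := 1) (hin.of_eqOutside hF₁) hvertex (fun a s' =>
    ∀ x : Fin n, s'.arr Arr.covered x = 0 ↔ u ≠ x ∧ x ∉ a ∧ ¬ Covered G S x) ?_ ?_ ?_).mono
      le_rfl fun s₂ hF₂ hcov₂ => ⟨?_, fun x => ?_⟩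
  · intro a s₂ s₃ hF hcov₂
    rwa [hF.arr Arr.covered (by decide)]
  · simpa using hcov
  · intro a x s₂ hF _ hnbr hcov₂
    refine .instr fun y => ?_
    have hone₂ : s₂.reg Reg.one = 1 := (hF.reg _ (by decide)).trans hone
    by_cases hxy : y = x <;> simp [hnbr, hone₂, Fin.val_inj, hxy, hcov₂]
  · rw [Outputs, hF₂.reg 1 (by decide), hF₂.arr 2 (by decide)]
    exact hout
  · rw [hcov₂, covered_insert, (hadj u).2]
    tauto

theorem treatPrevious_spec (hadj : IsAdjacencyList G adj) (hin : StoresInput adj s)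
    (hsearch : StoresSearch l p s) (hs : StoresSelection G S s) (hhead : s.reg Reg.head = k + 1)
    (hv : l[k]? = some v) (hpv : p v = v ∨ G.Adj (p v) v) :
    HaltsWithin treatPrevious (7 * (adj v).length + 16 +
        ∑ u ∈ greedyStep G p S v \ S, (4 * (adj u).length + 12)) s
      fun s' => s'.reg Reg.head = k ∧ StoresSelection G (greedyStep G p S v) s' := by
  refine ((testPrevious_spec hadj hin hsearch hs hhead hv).seq
    (k' := 1 + ∑ u ∈ greedyStep G p S v \ S, (4 * (adj u).length + 12) + 1) fun s₁ hF₁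
      ⟨hflag, hhead₁, hparent⟩ => .ifElse (fun hb => ?_) fun hb => ?_).of_le (by lia)
  all_goals
    have hin₁ : StoresInput adj s₁ := hin.of_eqOutside hF₁
    have hs₁ : StoresSelection G S s₁ := hs.of_eqOutside hF₁
    rw [Test.holds, hin₁.zero, hflag] at hb
  · rw [greedyStep, if_neg hb]
    exact (HaltsWithin.skip ⟨hhead₁, hs₁⟩).of_le (by lia)
  · have hneeds : NeedsParent G p S v := not_not.1 hb
    have hpS : p v ∉ S := fun hpS => hneeds.1 ⟨p v, hpS, hpv⟩
    rw [greedyStep, if_pos hneeds, Finset.insert_sdiff_cancel hpS, Finset.sum_singleton]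
    exact (select_spec hadj hin₁ hs₁ hparent hpS).mono (by lia) fun s₂ hF₂ hs₂ =>
      ⟨(hF₂.reg _ (by decide)).trans hhead₁, hs₂⟩

/-- The loop invariant of `greedySelection`: after `t` steps, the vertices of the queue from
position `k` on have been treated, and `s` holds the selection `S`. The two sums in the bound on `t`
pay for the treated and the selected vertices. -/
structure SelectionInvariant (G : SimpleGraph (Fin n)) (adj : Fin n → List (Fin n))
    (l : List (Fin n)) (p : Fin n → Fin n) (k : ℕ) (S : Finset (Fin n)) (t : ℕ) (s : State) :
    Prop where
  greedy : ∃ F, GreedyInvariant G l.idxOf p k S F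
  stores : StoresSelection G S s
  head : s.reg Reg.head = k
  head_le : k ≤ l.length
  time_le : t ≤ ((l.drop k).map fun v => 7 * (adj v).length + 18).sum +
    ∑ v ∈ S, (4 * (adj v).length + 12)

theorem SelectionInvariant.time_le_const {t : ℕ} (hI : SelectionInvariant G adj l p k S t s)
    (hl : l.Nodup) :
    t ≤ ∑ v, (7 * (adj v).length + 18) + ∑ v, (4 * (adj v).length + 12) :=
  hI.time_le.trans (Nat.add_le_add (sum_map_le_sum_univ (hl.sublist (List.drop_sublist k l)) _)
    (Finset.sum_le_sum_of_subset (Finset.subset_univ S)))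

theorem SelectionInvariant.treatPrevious {t : ℕ} (hG : IsBlockGraph G)
    (hadj : IsAdjacencyList G adj) (hin : StoresInput adj s) (hS : SearchState G l l.length p)
    (hl : ∀ v, v ∈ l) (hsearch : StoresSearch l p s)
    (hI : SelectionInvariant G adj l p (k + 1) S t s) :
    ∃ c S', HaltsWithin treatPrevious c s (SelectionInvariant G adj l p k S' (t + c + 1)) := by
  have hk : k < l.length := hI.head_le
  have hv : l[k]? = some l[k] := List.getElem?_eq_getElem hk
  obtain ⟨F, hF⟩ := hI.greedy
  refine ⟨_, greedyStep G p S l[k], (treatPrevious_spec hadj hin hsearch hI.stores hI.head hv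
    (hS.parent_adj (hl _))).mono le_rfl fun s' _ ⟨hhead, hs'⟩ => ⟨hF.step (hS.isBreadthFirst hl) hG
      (hS.idxOf_eq hv), hs', hhead, hk.le, ?_⟩⟩
  rw [List.drop_eq_getElem_cons hk, List.map_cons, List.sum_cons,
    ← Finset.sum_sdiff (subset_greedyStep G p S l[k])]
  linarith [hI.time_le]

theorem greedySelection_spec (hG : IsBlockGraph G) (hadj : IsAdjacencyList G adj)
    (hin : StoresInput adj s) (hS : SearchState G l l.length p) (hl : ∀ v, v ∈ l)
    (hsearch : StoresSearch l p s) (hs : StoresSelection G ∅ s)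
    (hhead : s.reg Reg.head = l.length) :
    HaltsWithin greedySelection
      (∑ v, (7 * (adj v).length + 18) + ∑ v, (4 * (adj v).length + 12) + 1) s
      fun s' => ∃ S, Outputs s' S ∧ IsMinimumVEDominatingSet G S := by
  refine .loop (fun t s' => ∃ k S, SelectionInvariant G adj l p k S t s') _ ?_ ?_ ?_ ?_
  · exact ⟨l.length, ∅, ⟨∅, .empty fun v => List.idxOf_lt_length_of_mem (hl v)⟩, hs, hhead,
      le_rfl, Nat.zero_le _⟩
  · rintro t s' ⟨k, S, hI⟩
    exact hI.time_le_const hS.nodup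
  · rintro t s' hF ⟨k, S, hI⟩ hpos
    obtain ⟨k, rfl⟩ : ∃ k', k = k' + 1 :=
      Nat.exists_eq_add_one_of_ne_zero (hI.head ▸ (Nat.zero_le _).trans_lt hpos).ne'
    obtain ⟨c, S', h⟩ := hI.treatPrevious hG hadj (hin.of_eqOutside hF) hS hl
      (hsearch.of_eqOutside hF)
    exact ⟨c, h.mono le_rfl fun s'' _ hI' => ⟨k, S', hI'⟩⟩
  · rintro t s' hF ⟨k, S, hI⟩ hguard
    obtain rfl : k = 0 := by simpa [(hin.of_eqOutside hF).zero, hI.head] using hguard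
    obtain ⟨F, hgreedy⟩ := hI.greedy
    exact ⟨S, hI.stores.outputs, hgreedy.isMinimumVEDominatingSet (hS.isBreadthFirst hl)⟩

end GreedySelection

end VEDom

theorem mainTheorem1 :
    ∃ (p : VEDom.Program) (C : ℕ),
      ∀ (n : ℕ) (G : SimpleGraph (Fin n)), VEDom.IsBlockGraph G →
        ∀ adj : Fin n → List (Fin n), VEDom.IsAdjacencyList G adj →
          ∃ (t : ℕ) (s : VEDom.State) (S : Finset (Fin n)),
            VEDom.Run p (VEDom.inputState adj) t s ∧
            t ≤ C * (n + G.edgeSet.ncard + 1) ∧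
            VEDom.Outputs s S ∧
            VEDom.IsMinimumVEDominatingSet G S := by
  refine ⟨.seq VEDom.breadthFirstSearch VEDom.greedySelection, 59, fun n G hG adj hadj => ?_⟩
  obtain ⟨t, ht, s, hrun, S, hout, hmin⟩ := (VEDom.breadthFirstSearch_spec hadj).seq
    fun s hF ⟨l, p, hS, hl, hsearch, hhead⟩ =>
      have hcount : s.reg VEDom.Reg.count = 0 := hF.reg _ (by decide)
      have hcovered (v : Fin n) : s.arr VEDom.Arr.covered v = 0 :=
        congrFun (hF.arr _ (by decide)) v
      VEDom.greedySelection_spec hG hadj ((VEDom.storesInput_inputState adj).of_eqOutside hF) hS hl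
        hsearch (VEDom.storesSelection_empty hcount hcovered) hhead
  refine ⟨t, s, S, hrun, ht.trans ?_, hout, hmin⟩
  simp only [VEDom.sum_mul_length_adj_add hadj]
  lia
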